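/- Let $G$ be a finite simple graph. Write $\tau(G)$ for the maximum number of vertices in an induced forest (acyclic induced subgraph) of $G$ and $\phi(G)$ for the minimum cardinality of a decycling set of $G$ (a set of vertices whose deletion leaves an acyclic graph). The girth of $G$ is the length of its shortest cycle, and $\infty$ if $G$ is acyclic. For an integer $r\ge 3$ and $p_0\in(0,1)$, consider the initial value problem on $[0,\infty)$ $$ \begin{aligned} \hat w' &= -r\hat s, \qquad \hat b' = -\hat b-r\hat t+r\hat s, \qquad \hat q'=-\frac{(2r-2)\hat q\hat s}{\hat w},\\ \hat s' &= -\hat s+\frac{(r-1)\hat q\hat s}{\hat w}-\frac{(r-1)\hat s^2}{\hat w}-\frac{r(r-2)\hat s\hat t}{(r-1)\hat b},\\ \hat t' &= -2\hat t+\frac{2(r-1)\hat s^2}{\hat w}-\frac{2r(r-2)\hat t^2}{(r-1)\hat b}, \end{aligned} $$ with $\hat w(0)=(1-p_0)^{r+1}$, $\hat b(0)=rp_0(1-p_0)^r$, $\hat q(0)=(1-p_0)^{2r}$, $\hat s(0)=(r-1)p_0(1-p_0)^{2r-1}$, $\hat t(0)=(r-1)^2p_0^2(1-p_0)^{2r-2}$.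 Put $$ \xi(r,p_0)=p_0(1-p_0)^r+\int_0^\infty \hat b(x)\,dx+ \begin{cases}\lim_{x\to\infty}\hat w(x) & \text{if } \lim_{x\to\infty}\frac{(r-1)\hat q(x)}{\hat w(x)}<1,\\ 0&\text{otherwise,}\end{cases} $$ where $(\hat w,\hat b,\hat q,\hat s,\hat t)$ is a solution that is positive on $[0,\infty)$. **Theorem.** (1) For every integer $r\ge 3$ and every $p_0\in(0,1)$ the number $\xi(r,p_0)$ is well defined: there is a positive solution for which the integral and both limits converge, and any two such solutions give the same value. Moreover, for every $\delta>0$ there is an integer $g>0$ such that every $r$-regular graph $G$ on $n$ vertices with girth at least $g$ satisfies $\tau(G)\ge(\xi(r,p_0)-\delta)n$. (2) For each row $(r,\xi,\Xi)$ of the table $$ \begin{array}{c|cccccccc} r&3&4&5&6&7&8&9&10\\ \hline \xi&0.7268&0.6045&0.5269&0.4711&0.4283&0.3940&0.3658&0.3419\\ \Xi&0.2732&0.3955&0.4731&0.5289&0.5717&0.6060&0.6342&0.6581 \end{array} $$ we have $\Xi=1-\xi$, and there is $p_0\in(0,1)$ for which $\xi$ is the truncation of $\xi(r,p_0)$ to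 four decimal places, that is, $\xi\le\xi(r,p_0)<\xi+10^{-4}$. Consequently, for every $\delta>0$ there is an integer $g>0$ such that every $r$-regular graph $G$ on $n$ vertices with girth at least $g$ satisfies $\tau(G)\ge(\xi-\delta)n$ and $\phi(G)\le(\Xi+\delta)n$. -/

import Mathlib

open Filter Topology MeasureTheory Set

/-- `τ(G)`: the maximum number of vertices in an induced forest of `G`. -/
noncomputable def inducedForestNumber {V : Type*} [Fintype V] (G : SimpleGraph V) : ℕ :=
  sSup {k : ℕ | ∃ S : Finset V, S.card = k ∧ (G.induce (S : Set V)).IsAcyclic}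

/-- `φ(G)`: the minimum cardinality of a decycling set of `G`, that is, of a set of vertices
whose deletion leaves an acyclic graph. -/
noncomputable def decyclingNumber {V : Type*} [Fintype V] (G : SimpleGraph V) : ℕ :=
  sInf {k : ℕ | ∃ S : Finset V, S.card = k ∧ (G.induce ((S : Set V)ᶜ)).IsAcyclic}

/-- `(w, b, q, s, t)` solves on `[0, ∞)` the system of differential equations associated with
`(r, p₀)`, including its initial conditions (the derivative at `0` is one-sided). -/
structure IsForestODESolution (r : ℕ) (p₀ : ℝ) (w b q s t : ℝ → ℝ) : Prop where
  deriv_w : ∀ x, 0 ≤ x → HasDerivWithinAt w (-(r * s x)) (Ici 0) x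
  deriv_b : ∀ x, 0 ≤ x → HasDerivWithinAt b (-b x - r * t x + r * s x) (Ici 0) x
  deriv_q : ∀ x, 0 ≤ x →
    HasDerivWithinAt q (-((2 * (r : ℝ) - 2) * q x * s x / w x)) (Ici 0) x
  deriv_s : ∀ x, 0 ≤ x →
    HasDerivWithinAt s
      (-s x + ((r : ℝ) - 1) * q x * s x / w x - ((r : ℝ) - 1) * s x ^ 2 / w x
        - (r : ℝ) * ((r : ℝ) - 2) * s x * t x / (((r : ℝ) - 1) * b x)) (Ici 0) x
  deriv_t : ∀ x, 0 ≤ x →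
    HasDerivWithinAt t
      (-2 * t x + 2 * ((r : ℝ) - 1) * s x ^ 2 / w x
        - 2 * (r : ℝ) * ((r : ℝ) - 2) * t x ^ 2 / (((r : ℝ) - 1) * b x)) (Ici 0) x
  init_w : w 0 = (1 - p₀) ^ (r + 1)
  init_b : b 0 = r * p₀ * (1 - p₀) ^ r
  init_q : q 0 = (1 - p₀) ^ (2 * r)
  init_s : s 0 = ((r : ℝ) - 1) * p₀ * (1 - p₀) ^ (2 * r - 1)
  init_t : t 0 = ((r : ℝ) - 1) ^ 2 * p₀ ^ 2 * (1 - p₀) ^ (2 * r - 2)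

open Classical in
/-- `c` is the constant `ξ(r, p₀)` obtained from the system associated with `(r, p₀)`: with
`wInf = lim w` and `ℓ = lim (r - 1) q / w`, it is `p₀ (1 - p₀) ^ r + ∫₀^∞ b`, plus `wInf` if
`ℓ < 1`. The solution, the convergence of the integral and both limits are part of the
assertion. -/
def IsForestConstant (r : ℕ) (p₀ c : ℝ) : Prop :=
  ∃ w b q s t : ℝ → ℝ, IsForestODESolution r p₀ w b q s t ∧
    (∀ x, 0 ≤ x → 0 < w x ∧ 0 < b x ∧ 0 < q x ∧ 0 < s x ∧ 0 < t x) ∧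
    IntegrableOn b (Ioi 0) ∧
    ∃ wInf ℓ : ℝ, Tendsto w atTop (𝓝 wInf) ∧
      Tendsto (fun x => ((r : ℝ) - 1) * q x / w x) atTop (𝓝 ℓ) ∧
      c = p₀ * (1 - p₀) ^ r + (∫ x in Ioi 0, b x) + if ℓ < 1 then wInf else 0

/-- The rows `(r, ξ(r), Ξ(r))` of the table of numerical values. -/
noncomputable def forestTable : List (ℕ × ℝ × ℝ) :=
  [(3, 0.7268, 0.2732), (4, 0.6045, 0.3955), (5, 0.5269, 0.4731), (6, 0.4711, 0.5289),
   (7, 0.4283, 0.5717), (8, 0.3940, 0.6060), (9, 0.3658, 0.6342), (10, 0.3419, 0.6581)]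

/-! Grow a random induced forest. Each vertex is a seed with probability `p`; then, in each of `N`
rounds, each vertex is chosen with small probability `ε` and joins if exactly one of its neighbours
has joined before. Keep the joined vertices without a neighbour born in the same round, together
with the untouched vertices (neither they nor their neighbours joined) that start no long untouched
walk. A cycle among the kept vertices cannot mix the two kinds. On a cycle of joined vertices, one
born last would have two neighbours that joined earlier; a cycle of untouched vertices is at least
as long as the girth, hence contains a long untouched walk (`not_isCycle_of_subset_forestSet`).

Large girth makes the branches at a vertex independent, so exact expectations follow from a
two-variable recursion `branchLaw` (`coinExp_branchLaw`): `v` is the probability that a branch has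
not reached its root, `a` the probability that it has reached it and the root has not been chosen
since. As `ε → 0` this becomes `v' = -(1-p)(r-1) a v^(r-2)`, `a' = -a - v'`, whence `da/dv =
1/((1-p)(r-1)v^(r-2)) - 1`. Thus `a = potential v`, a concave function with a single zero `z` below
`1 - p`, and `v` decreases to `z`. Concavity also keeps the discrete recursion on the favourable
side of this curve (`branchLaw_bounds`). Isolated seeds, joined vertices and untouched vertices
contribute the three terms of `forestValue` at `z` (`le_inducedForestNumber`, `sum_branchLaw_ge`).
The slope of the potential at `z` is positive, which says exactly that untouched walks are
subcritical; those of `K` steps have exponentially small probability.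

The five-dimensional system is the same flow in other coordinates. Along a positive solution `t =
s²/q`, `b = r/(r-1) · sw/q`, and with `v = w/√q` also `w = (1-p)v^r` and `s/√q = rate v`. Each
identity holds because the defect solves a linear homogeneous equation with nonpositive coefficient
and starts at zero. Hence all positive solutions give the value `forestValue r p z`
(`isForestConstant_iff`); subcriticality means that the second case of the definition of `ξ` never
occurs. Existence follows by inverting the travel time of the scalar equation. The table is obtained
by enclosing `z`, since `forestValue` decreases on `[0, z]` and as long as the branching number is
at most one. -/

/-! ### Finite product measures on coin configurations. -/

section BernoulliExpectation

/-- The probability of the outcome `ω` of independent coins, the coin `i` showing `true` with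
probability `β i`. -/
noncomputable def coinWeight {ι : Type*} [Fintype ι] (β : ι → ℝ) (ω : ι → Bool) : ℝ :=
  ∏ i, if ω i then β i else 1 - β i

/-- The expectation of `f` under independent coins with biases `β`. -/
noncomputable def coinExp {ι : Type*} [Fintype ι] [DecidableEq ι] (β : ι → ℝ) (f : (ι → Bool) → ℝ) : ℝ :=
  ∑ ω, coinWeight β ω * f ω

variable {ι : Type*} [Fintype ι] [DecidableEq ι] (β : ι → ℝ)

lemma coinWeight_nonneg {ι : Type*} [Fintype ι] (β : ι → ℝ) (h0 : ∀ i, 0 ≤ β i) (h1 : ∀ i, β i ≤ 1) (ω : ι → Bool) :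
    0 ≤ coinWeight β ω :=
  Finset.prod_nonneg fun i _ => by
    split_ifs
    · exact h0 i
    · linarith [h1 i]

lemma sum_coinWeight : ∑ ω, coinWeight β ω = 1 := by
  have h := Finset.prod_univ_sum (fun _ : ι => (Finset.univ : Finset Bool))
    (fun i b => if b then β i else 1 - β i)
  rw [Fintype.piFinset_univ] at h
  unfold coinWeight
  rw [← h]
  simp

lemma coinExp_const (c : ℝ) : coinExp β (fun _ => c) = c := by
  simp [coinExp, ← Finset.sum_mul, sum_coinWeight]

lemma coinExp_add (f g : (ι → Bool) → ℝ) :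
    coinExp β (fun ω => f ω + g ω) = coinExp β f + coinExp β g := by
  simp [coinExp, mul_add, Finset.sum_add_distrib]

lemma coinExp_sub (f g : (ι → Bool) → ℝ) :
    coinExp β (fun ω => f ω - g ω) = coinExp β f - coinExp β g := by
  simp [coinExp, mul_sub, Finset.sum_sub_distrib]

lemma coinExp_sum {κ : Type*} (s : Finset κ) (f : κ → (ι → Bool) → ℝ) :
    coinExp β (fun ω => ∑ k ∈ s, f k ω) = ∑ k ∈ s, coinExp β (f k) := by
  simp only [coinExp, Finset.mul_sum]
  exact Finset.sum_comm

lemma coinExp_mono (h0 : ∀ i, 0 ≤ β i) (h1 : ∀ i, β i ≤ 1) {f g : (ι → Bool) → ℝ}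
    (h : ∀ ω, f ω ≤ g ω) : coinExp β f ≤ coinExp β g :=
  Finset.sum_le_sum fun ω _ => mul_le_mul_of_nonneg_left (h ω) (coinWeight_nonneg β h0 h1 ω)

lemma exists_coinExp_le (h0 : ∀ i, 0 ≤ β i) (h1 : ∀ i, β i ≤ 1) (f : (ι → Bool) → ℝ) :
    ∃ ω, coinExp β f ≤ f ω := by
  obtain ⟨ω, -, hω⟩ := Finset.exists_max_image Finset.univ f ⟨fun _ => false, Finset.mem_univ _⟩
  refine ⟨ω, (coinExp_mono β h0 h1 (g := fun _ => f ω) fun ω' => hω ω' (Finset.mem_univ _)).trans ?_⟩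
  rw [coinExp_const]

open Classical in
/-- Exchange the coordinates in `S` of two configurations. -/
noncomputable def coinSwap {ι : Type*} (S : Set ι) (x : (ι → Bool) × (ι → Bool)) : (ι → Bool) × (ι → Bool) :=
  (fun i => if i ∈ S then x.1 i else x.2 i, fun i => if i ∈ S then x.2 i else x.1 i)

lemma coinSwap_involutive {ι : Type*} (S : Set ι) : Function.Involutive (coinSwap S) := by
  intro x
  refine Prod.ext ?_ ?_ <;> funext i <;> by_cases h : i ∈ S <;> simp [coinSwap, h]

lemma coinWeight_coinSwap {ι : Type*} [Fintype ι] (β : ι → ℝ) (S : Set ι) (x : (ι → Bool) × (ι → Bool)) :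
    coinWeight β (coinSwap S x).1 * coinWeight β (coinSwap S x).2 =
      coinWeight β x.1 * coinWeight β x.2 := by
  simp only [coinWeight, ← Finset.prod_mul_distrib]
  refine Finset.prod_congr rfl fun i _ => ?_
  by_cases h : i ∈ S <;> simp [coinSwap, h, mul_comm]

/-- Functions of disjoint sets of coins are independent. -/
lemma coinExp_mul {f g : (ι → Bool) → ℝ} {S T : Set ι} (hf : DependsOn f S) (hg : DependsOn g T)
    (hST : Disjoint S T) :
    coinExp β (fun ω => f ω * g ω) = coinExp β f * coinExp β g := by
  have key : coinExp β f * coinExp β g =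
      ∑ x : (ι → Bool) × (ι → Bool), coinWeight β x.1 * coinWeight β x.2 * (f x.1 * g x.2) := by
    rw [coinExp, coinExp, Finset.sum_mul_sum, Fintype.sum_prod_type]
    exact Finset.sum_congr rfl fun _ _ => Finset.sum_congr rfl fun _ _ => by ring
  have key2 : coinExp β (fun ω => f ω * g ω) =
      ∑ x : (ι → Bool) × (ι → Bool), coinWeight β x.1 * coinWeight β x.2 * (f x.1 * g x.1) := by
    rw [coinExp, Fintype.sum_prod_type]
    refine Finset.sum_congr rfl fun ω _ => ?_
    simp only
    rw [← Finset.sum_mul, ← Finset.mul_sum, sum_coinWeight, mul_one]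
  rw [key, key2]
  -- Exchanging the coordinates in `S` preserves the product weight. The first new configuration
  -- agrees with `x.1` on `S`, the second agrees with `x.1` off `S`, so `f x.1 * g x.1` turns into a
  -- product over two independent copies.
  refine (Fintype.sum_equiv (coinSwap_involutive S).toPerm _ _ fun x => ?_).symm
  simp only [Function.Involutive.coe_toPerm]
  rw [coinWeight_coinSwap]
  congr 2
  · exact hf fun i hi => by simp [coinSwap, hi]
  · exact hg fun i hi => by
      have : i ∉ S := fun h => Set.disjoint_left.1 hST h hi
      simp [coinSwap, this]

lemma dependsOn_prod {ι κ : Type*} (s : Finset κ) (f : κ → (ι → Bool) → ℝ) (S : κ → Set ι)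
    (hf : ∀ k ∈ s, DependsOn (f k) (S k)) :
    DependsOn (fun ω => ∏ k ∈ s, f k ω) (⋃ k ∈ s, S k) := by
  intro x y h
  exact Finset.prod_congr rfl fun k hk => hf k hk fun i hi => h i (Set.mem_biUnion hk hi)

lemma coinExp_prod {κ : Type*} (s : Finset κ) (f : κ → (ι → Bool) → ℝ) (S : κ → Set ι)
    (hf : ∀ k ∈ s, DependsOn (f k) (S k))
    (hS : ∀ k ∈ s, ∀ l ∈ s, k ≠ l → Disjoint (S k) (S l)) :
    coinExp β (fun ω => ∏ k ∈ s, f k ω) = ∏ k ∈ s, coinExp β (f k) := by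
  classical
  induction s using Finset.induction_on with
  | empty => simpa using coinExp_const β 1
  | insert a s ha ih =>
    simp only [Finset.prod_insert ha]
    rw [coinExp_mul β (hf a (Finset.mem_insert_self a s))
      (dependsOn_prod s f S fun k hk => hf k (Finset.mem_insert_of_mem hk)),
      ih (fun k hk => hf k (Finset.mem_insert_of_mem hk)) fun k hk l hl =>
        hS k (Finset.mem_insert_of_mem hk) l (Finset.mem_insert_of_mem hl)]
    refine Set.disjoint_iUnion₂_right.2 fun k hk => hS a (Finset.mem_insert_self a s) k
      (Finset.mem_insert_of_mem hk) ?_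
    rintro rfl
    exact ha hk

lemma coinExp_coin (i : ι) (h : Bool → ℝ) :
    coinExp β (fun ω => h (ω i)) = β i * h true + (1 - β i) * h false := by
  have key := Finset.prod_univ_sum (fun _ : ι => (Finset.univ : Finset Bool))
    (fun j b => (if b then β j else 1 - β j) * (if j = i then h b else 1))
  rw [Fintype.piFinset_univ] at key
  have e : ∀ ω : ι → Bool, coinWeight β ω * h (ω i) =
      ∏ j, (if ω j then β j else 1 - β j) * (if j = i then h (ω j) else 1) := by
    intro ω
    rw [Finset.prod_mul_distrib, Finset.prod_ite_eq' Finset.univ i]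
    simp [coinWeight]
  unfold coinExp
  rw [Finset.sum_congr rfl fun ω _ => e ω, ← key, Finset.prod_eq_single i]
  · simp
  · intro j _ hj
    simp [hj]
  · simp

end BernoulliExpectation

/-! ### Uniqueness of short paths and disjointness of branches under large girth. -/

section ShortPaths

namespace SimpleGraph

variable {V : Type*} {G : SimpleGraph V}

/-- Two paths with the same ends whose total length is less than the girth coincide. -/
lemma Walk.IsPath.eq_of_length_add_lt_egirth {a b : V} {p q : G.Walk a b} (hp : p.IsPath)
    (hq : q.IsPath) (h : ((p.length + q.length : ℕ) : ℕ∞) < G.egirth) : p = q := by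
  classical
  -- The union of the two paths has fewer edges than the girth, hence contains no cycle, and paths
  -- in a forest are unique.
  let H : SimpleGraph V := fromEdgeSet {e | e ∈ p.edges ∨ e ∈ q.edges}
  have hHmem : ∀ e, e ∈ G.edgeSet → (e ∈ p.edges ∨ e ∈ q.edges) → e ∈ H.edgeSet := by
    intro e he h'
    rw [edgeSet_fromEdgeSet]
    exact ⟨h', G.not_isDiag_of_mem_edgeSet he⟩
  have hHG : H ≤ G := by
    intro x y hxy
    rw [fromEdgeSet_adj] at hxy
    rcases hxy.1 with h | h
    · exact p.edges_subset_edgeSet h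
    · exact q.edges_subset_edgeSet h
  have hac : H.IsAcyclic := by
    intro x c hc
    have h1 : G.egirth ≤ (c.mapLe hHG).length := egirth_le_length (hc.mapLe hHG)
    rw [Walk.length_map] at h1
    have h2 : c.edges.toFinset ⊆ (p.edges ++ q.edges).toFinset := by
      intro e he
      rw [List.mem_toFinset] at he ⊢
      have := c.edges_subset_edgeSet he
      rw [edgeSet_fromEdgeSet] at this
      simpa using this.1
    have h3 := Finset.card_le_card h2
    rw [List.toFinset_card_of_nodup hc.edges_nodup, Walk.length_edges] at h3
    have h4 := (p.edges ++ q.edges).toFinset_card_le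
    rw [List.length_append, Walk.length_edges, Walk.length_edges] at h4
    have h5 : (c.length : ℕ∞) ≤ ((p.length + q.length : ℕ) : ℕ∞) := by exact_mod_cast h3.trans h4
    exact absurd (h1.trans h5) (not_le.2 h)
  have hpt : ∀ e ∈ p.edges, e ∈ H.edgeSet :=
    fun e he => hHmem e (p.edges_subset_edgeSet he) (Or.inl he)
  have hqt : ∀ e ∈ q.edges, e ∈ H.edgeSet :=
    fun e he => hHmem e (q.edges_subset_edgeSet he) (Or.inr he)
  have := congrArg Subtype.val
    ((hac.subsingleton_path a b).elim ⟨p.transfer H hpt, hp.transfer hpt⟩ ⟨q.transfer H hqt, hq.transfer hqt⟩)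
  simp only at this
  have h' := congrArg (fun w => w.support) this
  simp only [Walk.support_transfer] at h'
  exact Walk.ext_support h'

/-- The vertices that can be reached from `u` by a non-backtracking walk of at most `j` steps
whose first step does not lead to `w`. -/
def branchBall (G : SimpleGraph V) : ℕ → V → V → Set V
  | 0, u, _ => {u}
  | j + 1, u, w => {u} ∪ ⋃ c ∈ {c | G.Adj u c ∧ c ≠ w}, branchBall G j c u

lemma self_mem_branchBall (j : ℕ) (u w : V) : u ∈ G.branchBall j u w := by
  cases j <;> simp [branchBall]

lemma branchBall_subset_succ {j : ℕ} {u w c : V} (h : G.Adj u c) (hc : c ≠ w) :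
    G.branchBall j c u ⊆ G.branchBall (j + 1) u w := by
  intro x hx
  exact Or.inr (Set.mem_biUnion (show c ∈ {c | G.Adj u c ∧ c ≠ w} from ⟨h, hc⟩) hx)

lemma branchBall_mono {j k : ℕ} (hjk : j ≤ k) (u w : V) :
    G.branchBall j u w ⊆ G.branchBall k u w := by
  induction j generalizing k u w with
  | zero =>
    rintro x rfl
    exact self_mem_branchBall _ _ _
  | succ j ih =>
    obtain ⟨k, rfl⟩ : ∃ k', k = k' + 1 := ⟨k - 1, by omega⟩
    rintro x (hx | hx)
    · exact Or.inl hx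
    · obtain ⟨c, hc, hx⟩ := Set.mem_iUnion₂.1 hx
      exact Or.inr (Set.mem_biUnion hc (ih (by omega) c u hx))

/-- Non-backtracking walks shorter than the girth are paths. If the path from the child `c` met `w`,
its initial part preceded by the step `u → c` would be a second short path from `u` to `w` besides
the edge, forcing `c = w`. -/
lemma exists_isPath_of_mem_branchBall {j : ℕ} (hg : ((j + 2 : ℕ) : ℕ∞) < G.egirth) {u w x : V}
    (h : G.Adj w u) (hx : x ∈ G.branchBall j u w) :
    ∃ p : G.Walk u x, p.IsPath ∧ p.length ≤ j ∧ w ∉ p.support := by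
  classical
  induction j generalizing u w with
  | zero =>
    obtain rfl : x = u := hx
    exact ⟨.nil, .nil, le_rfl, by simpa using h.ne⟩
  | succ j ih =>
    rcases hx with hx | hx
    · obtain rfl : x = u := hx
      exact ⟨.nil, .nil, Nat.zero_le _, by simpa using h.ne⟩
    · obtain ⟨c, hc, hx⟩ := Set.mem_iUnion₂.1 hx
      have hg' : ((j + 2 : ℕ) : ℕ∞) < G.egirth := lt_of_le_of_lt (by exact_mod_cast (by omega)) hg
      obtain ⟨p, hp, hl, hu⟩ := ih hg' hc.1 hx
      refine ⟨.cons hc.1 p, hp.cons hu, by simpa using hl, ?_⟩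
      rw [Walk.support_cons, List.mem_cons, not_or]
      refine ⟨h.ne, fun hw => ?_⟩
      have hq : (Walk.cons hc.1 (p.takeUntil w hw)).IsPath :=
        (hp.takeUntil hw).cons fun h' => hu (p.support_takeUntil_subset_support hw h')
      have hlen := p.length_takeUntil_le_length hw
      have := hq.eq_of_length_add_lt_egirth (Walk.IsPath.of_adj h.symm) (by
        refine lt_of_le_of_lt ?_ hg
        simp only [Walk.length_cons, Walk.length_nil]
        exact_mod_cast (by omega))
      have := congrArg Walk.snd this
      simp at this
      exact hc.2 this

lemma notMem_branchBall {j : ℕ} (hg : ((j + 2 : ℕ) : ℕ∞) < G.egirth) {u w : V}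
    (h : G.Adj w u) : w ∉ G.branchBall j u w := by
  intro hx
  obtain ⟨p, -, -, hw⟩ := exists_isPath_of_mem_branchBall hg h hx
  exact hw p.end_mem_support

/-- A common vertex would give two short paths from `u` with different first steps. This is the
source of independence between branches. -/
lemma disjoint_branchBall {j : ℕ} (hg : ((2 * j + 2 : ℕ) : ℕ∞) < G.egirth) {u c c' : V}
    (h : G.Adj u c) (h' : G.Adj u c') (hne : c ≠ c') :
    Disjoint (G.branchBall j c u) (G.branchBall j c' u) := by
  have hg' : ((j + 2 : ℕ) : ℕ∞) < G.egirth := lt_of_le_of_lt (by exact_mod_cast (by omega)) hg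
  refine Set.disjoint_left.2 fun x hx hx' => ?_
  obtain ⟨p, hp, hl, hu⟩ := exists_isPath_of_mem_branchBall hg' h hx
  obtain ⟨p', hp', hl', hu'⟩ := exists_isPath_of_mem_branchBall hg' h' hx'
  have := (hp.cons (h := h) hu).eq_of_length_add_lt_egirth (hp'.cons (h := h') hu') (by
    refine lt_of_le_of_lt ?_ hg
    simp only [Walk.length_cons]
    exact_mod_cast (by omega))
  have := congrArg Walk.snd this
  simp at this
  exact hne this

end SimpleGraph

end ShortPaths

/-! ### The growth process and its description along branches. -/

section Growth

variable {V : Type*}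

/-- The growth process driven by `X`: the seeds are the vertices with `X 0`, and in round `j + 1`
a vertex with `X (j + 1)` joins if exactly one of its neighbours has joined before. -/
def grown (G : SimpleGraph V) (X : ℕ → V → Prop) : ℕ → V → Prop
  | 0, u => X 0 u
  | j + 1, u => grown G X j u ∨ (X (j + 1) u ∧ ∃! c, G.Adj u c ∧ grown G X j c)

/-- The growth process at `u`, run along non-backtracking walks that start at `u` and avoid `w` in
their first step. -/
def grownVia (G : SimpleGraph V) (X : ℕ → V → Prop) : ℕ → V → V → Prop
  | 0, u, _ => X 0 u
  | j + 1, u, w =>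
    grownVia G X j u w ∨ (X (j + 1) u ∧ ∃! c, (G.Adj u c ∧ c ≠ w) ∧ grownVia G X j c u)

/-- In the process at `u` avoiding `w`, the vertex `u` can be added after round `j`. -/
def ready (G : SimpleGraph V) (X : ℕ → V → Prop) (j : ℕ) (u w : V) : Prop :=
  ¬ grownVia G X j u w ∧ ∃! c, (G.Adj u c ∧ c ≠ w) ∧ grownVia G X j c u

/-- The branch of `c` has reached `u` by round `j`, and `u` has not been chosen since. -/
def triggered (G : SimpleGraph V) (X : ℕ → V → Prop) (j : ℕ) (c u : V) : Prop :=
  grownVia G X j c u ∧ ∀ i < j, grownVia G X i c u → ¬ X (i + 1) u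

variable {G : SimpleGraph V} {X X' : ℕ → V → Prop}

lemma grown_mono {i j : ℕ} (hij : i ≤ j) {u : V} (h : grown G X i u) : grown G X j u := by
  induction hij with
  | refl => exact h
  | step _ ih => exact Or.inl ih

lemma grownVia_mono {i j : ℕ} (hij : i ≤ j) {u w : V} (h : grownVia G X i u w) :
    grownVia G X j u w := by
  induction hij with
  | refl => exact h
  | step _ ih => exact Or.inl ih

lemma grownVia_congr {j : ℕ} {u w : V}
    (h : ∀ i ≤ j, ∀ x ∈ G.branchBall j u w, (X i x ↔ X' i x)) :
    grownVia G X j u w ↔ grownVia G X' j u w := by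
  induction j generalizing u w with
  | zero => exact h 0 le_rfl u rfl
  | succ j ih =>
    have h1 : grownVia G X j u w ↔ grownVia G X' j u w :=
      ih fun i hi x hx => h i (by omega) x (G.branchBall_mono (Nat.le_succ j) u w hx)
    have h2 : ∀ c, (G.Adj u c ∧ c ≠ w) ∧ grownVia G X j c u ↔
        (G.Adj u c ∧ c ≠ w) ∧ grownVia G X' j c u := fun c =>
      and_congr_right fun hc => ih fun i hi x hx =>
        h i (by omega) x (G.branchBall_subset_succ hc.1 hc.2 hx)
    simp only [grownVia, h1, h (j + 1) le_rfl u (G.self_mem_branchBall _ _ _), h2]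

lemma triggered_congr {j : ℕ} {c u : V}
    (h : ∀ i ≤ j, ∀ x ∈ G.branchBall j c u, (X i x ↔ X' i x))
    (hu : ∀ i < j, (X (i + 1) u ↔ X' (i + 1) u)) :
    triggered G X j c u ↔ triggered G X' j c u := by
  refine and_congr (grownVia_congr h) (forall₂_congr fun i hi => ?_)
  rw [hu i hi, grownVia_congr (X' := X') fun k hk x hx =>
    h k (by omega) x (G.branchBall_mono hi.le c u hx)]

lemma triggered_succ_iff {j : ℕ} {c u : V} :
    triggered G X (j + 1) c u ↔ (grownVia G X (j + 1) c u ∧ ¬ grownVia G X j c u) ∨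
      (triggered G X j c u ∧ ¬ X (j + 1) u) := by
  constructor
  · rintro ⟨h1, h2⟩
    by_cases h : grownVia G X j c u
    · exact Or.inr ⟨⟨h, fun i hi => h2 i (by omega)⟩, h2 j (by omega) h⟩
    · exact Or.inl ⟨h1, h⟩
  · rintro (⟨h1, h2⟩ | ⟨⟨h1, h2⟩, h3⟩)
    · exact ⟨h1, fun i hi h => absurd (grownVia_mono (Nat.lt_succ_iff.1 hi) h) h2⟩
    · refine ⟨grownVia_mono (Nat.le_succ j) h1, fun i hi h => ?_⟩
      rcases Nat.lt_succ_iff_lt_or_eq.1 hi with hi | rfl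
      · exact h2 i hi h
      · exact h3

/-- This splits the event according to the only child whose branch has reached `u`. The conditions
then concern disjoint sets of coins: the initial coin of `u`, the branch of `c` with the later coins
of `u`, and each other branch. That `u` has not joined becomes the requirement in `triggered` that
it was never chosen after `c`. -/
lemma ready_iff {j : ℕ} {u w : V} :
    ready G X j u w ↔ ∃ c, (G.Adj u c ∧ c ≠ w) ∧ ¬ X 0 u ∧ triggered G X j c u ∧
      ∀ c', (G.Adj u c' ∧ c' ≠ w) → c' ≠ c → ¬ grownVia G X j c' u := by
  constructor
  · rintro ⟨hn, c, ⟨hc, hg⟩, huniq⟩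
    refine ⟨c, hc, fun h => hn (grownVia_mono (Nat.zero_le j) h), ⟨hg, fun i hi hic hX => ?_⟩,
      fun c' hc' hne h => hne (huniq c' ⟨hc', h⟩)⟩
    refine hn (grownVia_mono (Nat.succ_le_of_lt hi) (Or.inr ⟨hX, c, ⟨hc, hic⟩, ?_⟩))
    rintro c' ⟨hc', h⟩
    exact huniq c' ⟨hc', grownVia_mono hi.le h⟩
  · rintro ⟨c, hc, h0, ⟨hg, hX⟩, hne⟩
    refine ⟨?_, c, ⟨hc, hg⟩, fun c' h => by_contra fun h' => hne c' h.1 h' h.2⟩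
    have : ∀ i ≤ j, ¬ grownVia G X i u w := by
      intro i
      induction i with
      | zero => exact fun _ => h0
      | succ i ih =>
        rintro hi (h | ⟨h, c', ⟨hc', hg'⟩, -⟩)
        · exact ih (by omega) h
        · obtain rfl : c' = c := by_contra fun h' => hne c' hc' h' (grownVia_mono (by omega) hg')
          exact hX i (by omega) hg' h
    exact this j le_rfl

/-- A neighbour `w` that has not joined is never counted at `u`, so forbidding the step to it
changes nothing. In the induction `u` and its neighbours exchange roles: while `u` has not joined,
it is not counted at its neighbours. No girth condition enters. -/
lemma grown_iff_grownVia {j : ℕ} {u w : V} (h : G.Adj u w) (hw : ¬ grown G X j w) :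
    grown G X j u ↔ grownVia G X j u w := by
  induction j generalizing u w with
  | zero => rfl
  | succ j ih =>
    have hw' : ¬ grown G X j w := fun h' => hw (grown_mono (Nat.le_succ j) h')
    simp only [grown, grownVia]
    rw [ih h hw']
    by_cases hu : grownVia G X j u w
    · simp [hu]
    · have hu' : ¬ grown G X j u := by rwa [ih h hw']
      have : ∀ c, (G.Adj u c ∧ grown G X j c) ↔ ((G.Adj u c ∧ c ≠ w) ∧ grownVia G X j c u) := by
        intro c
        constructor
        · rintro ⟨hc, hg⟩
          exact ⟨⟨hc, fun h' => hw' (h' ▸ hg)⟩, (ih hc.symm hu').1 hg⟩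
        · rintro ⟨⟨hc, -⟩, hg⟩
          exact ⟨hc, (ih hc.symm hu').2 hg⟩
      simp only [this]

lemma existsUnique_grown_iff {j : ℕ} {v : V} (hv : ¬ grown G X j v) :
    (∃! c, G.Adj v c ∧ grown G X j c) ↔ ∃! c, (G.Adj v c ∧ c ≠ v) ∧ grownVia G X j c v := by
  have : ∀ c, (G.Adj v c ∧ grown G X j c) ↔ ((G.Adj v c ∧ c ≠ v) ∧ grownVia G X j c v) := fun c =>
    ⟨fun h => ⟨⟨h.1, h.1.ne'⟩, (grown_iff_grownVia h.1.symm hv).1 h.2⟩,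
      fun h => ⟨h.1.1, (grown_iff_grownVia h.1.1.symm hv).2 h.2⟩⟩
  simp only [this]

lemma grown_iff_grownVia_self {j : ℕ} {v : V} : grown G X j v ↔ grownVia G X j v v := by
  induction j with
  | zero => rfl
  | succ j ih =>
    simp only [grown, grownVia, ← ih]
    by_cases hv : grown G X j v
    · simp [hv]
    · rw [existsUnique_grown_iff hv]

/-- If no branch reaches `v`, then `v` never has a joined neighbour and cannot join after the
initial round; so being untouched is a conjunction of events on separate branches. -/
lemma not_grown_nbhd_iff {j : ℕ} {v : V} :
    (¬ grown G X j v ∧ ∀ c, G.Adj v c → ¬ grown G X j c) ↔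
      ¬ X 0 v ∧ ∀ c, G.Adj v c → ¬ grownVia G X j c v := by
  constructor
  · rintro ⟨h, hc⟩
    exact ⟨fun h' => h (grown_mono (Nat.zero_le j) h'), fun c hvc h' =>
      hc c hvc ((grown_iff_grownVia hvc.symm h).2 h')⟩
  · rintro ⟨h, hc⟩
    have : ∀ i ≤ j, ¬ grownVia G X i v v := by
      intro i
      induction i with
      | zero => exact fun _ => h
      | succ i ih =>
        rintro hi (h' | ⟨-, c, ⟨hc', hg'⟩, -⟩)
        · exact ih (by omega) h'
        · exact hc c hc'.1 (grownVia_mono (by omega) hg')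
    have hv : ¬ grown G X j v := by
      rw [grown_iff_grownVia_self]
      exact this j le_rfl
    exact ⟨hv, fun c hvc h' => hc c hvc ((grown_iff_grownVia hvc.symm hv).1 h')⟩

/-- There is a walk of `K` steps from `u`, not stepping to `w` first, none of whose vertices has a
neighbour that has joined by round `N` (as seen along non-backtracking walks). -/
def whiteWalk (G : SimpleGraph V) (X : ℕ → V → Prop) (N : ℕ) : ℕ → V → V → Prop
  | 0, _, _ => True
  | K + 1, u, w => ∃ c, (G.Adj u c ∧ c ≠ w) ∧ ¬ X 0 u ∧ whiteWalk G X N K c u ∧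
      ∀ c', (G.Adj u c' ∧ c' ≠ w) → c' ≠ c → ¬ grownVia G X N c' u

lemma whiteWalk_congr {N K : ℕ} {u w : V}
    (h : ∀ i, ∀ x ∈ G.branchBall (N + K) u w, (X i x ↔ X' i x)) :
    whiteWalk G X N K u w ↔ whiteWalk G X' N K u w := by
  induction K generalizing u w with
  | zero => rfl
  | succ K ih =>
    simp only [whiteWalk]
    refine exists_congr fun c => and_congr_right fun hc => and_congr ?_ (and_congr ?_ ?_)
    · rw [h 0 u (G.self_mem_branchBall _ _ _)]
    · exact ih fun i x hx => h i x (G.branchBall_subset_succ hc.1 hc.2 hx)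
    · refine forall₃_congr fun c' hc' _ => not_congr (grownVia_congr fun i _ x hx => h i x ?_)
      exact G.branchBall_subset_succ hc'.1 hc'.2 (G.branchBall_mono (Nat.le_add_right N K) c' u hx)

lemma whiteWalk_of_isPath {N : ℕ} {u w z : V} (p : G.Walk u z) (hp : p.IsPath)
    (hw : w ∉ p.support.tail)
    (hwhite : ∀ x ∈ p.support, ¬ grown G X N x ∧ ∀ c, G.Adj x c → ¬ grown G X N c) :
    whiteWalk G X N p.length u w := by
  induction p generalizing w with
  | nil => trivial
  | @cons u c z h p ih =>
    rw [SimpleGraph.Walk.cons_isPath_iff] at hp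
    rw [SimpleGraph.Walk.support_cons, List.tail_cons] at hw
    have hu := not_grown_nbhd_iff.1 (hwhite u (by simp))
    refine ⟨c, ⟨h, fun h' => hw (h' ▸ p.start_mem_support)⟩, hu.1, ?_, fun c' hc' _ => hu.2 c' hc'.1⟩
    exact ih hp.1 (fun h' => hp.2 (List.mem_of_mem_tail h')) fun x hx => hwhite x (by simp [hx])

end Growth

/-! ### Independence of branches and the exact law of the process. -/

section ProcessLaw

open Classical in
/-- The indicator of a proposition. -/
noncomputable def ind (P : Prop) : ℝ := if P then 1 else 0

lemma ind_nonneg (P : Prop) : 0 ≤ ind P := by unfold ind; split_ifs <;> norm_num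

lemma ind_le_one (P : Prop) : ind P ≤ 1 := by unfold ind; split_ifs <;> norm_num

lemma ind_of {P : Prop} (h : P) : ind P = 1 := if_pos h

lemma ind_of_not {P : Prop} (h : ¬ P) : ind P = 0 := if_neg h

lemma ind_not (P : Prop) : ind (¬ P) = 1 - ind P := by
  by_cases h : P <;> simp [ind, h]

lemma ind_and (P Q : Prop) : ind (P ∧ Q) = ind P * ind Q := by
  by_cases h : P <;> by_cases h' : Q <;> simp [ind, h, h']

lemma ind_or {P Q : Prop} (h : P → ¬ Q) : ind (P ∨ Q) = ind P + ind Q := by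
  by_cases hP : P
  · simp [ind, hP, h hP]
  · by_cases hQ : Q <;> simp [ind, hP, hQ]

lemma ind_forall_mem {κ : Type*} (s : Finset κ) (P : κ → Prop) :
    ind (∀ k ∈ s, P k) = ∏ k ∈ s, ind (P k) := by
  by_cases h : ∀ k ∈ s, P k
  · rw [ind_of h, Finset.prod_eq_one fun k hk => ind_of (h k hk)]
  · rw [ind_of_not h]
    push Not at h
    obtain ⟨k, hk, hP⟩ := h
    exact (Finset.prod_eq_zero hk (ind_of_not hP)).symm

lemma ind_exists_mem_le {κ : Type*} (s : Finset κ) (P : κ → Prop) :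
    ind (∃ k ∈ s, P k) ≤ ∑ k ∈ s, ind (P k) := by
  by_cases h : ∃ k ∈ s, P k
  · obtain ⟨k, hk, hP⟩ := h
    rw [ind_of ⟨k, hk, hP⟩, ← ind_of hP]
    exact Finset.single_le_sum (f := fun k => ind (P k)) (fun k _ => ind_nonneg _) hk
  · rw [ind_of_not h]
    exact Finset.sum_nonneg fun k _ => ind_nonneg _

lemma ind_exists_mem_eq {κ : Type*} (s : Finset κ) (P : κ → Prop)
    (hP : ∀ k ∈ s, ∀ l ∈ s, P k → P l → k = l) :
    ind (∃ k ∈ s, P k) = ∑ k ∈ s, ind (P k) := by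
  by_cases h : ∃ k ∈ s, P k
  · obtain ⟨k, hk, hPk⟩ := h
    rw [ind_of ⟨k, hk, hPk⟩, Finset.sum_eq_single k, ind_of hPk]
    · exact fun l hl hne => ind_of_not fun hPl => hne (hP l hl k hk hPl hPk)
    · exact fun h' => absurd hk h'
  · rw [ind_of_not h]
    push Not at h
    exact (Finset.sum_eq_zero fun k hk => ind_of_not (h k hk)).symm

/-- The pair of the probabilities that a branch has not reached its root after `j` rounds, and
that it has reached its root, which has not been chosen since. -/
noncomputable def branchLaw (r : ℕ) (p ε : ℝ) : ℕ → ℝ × ℝ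
  | 0 => (1 - p, p)
  | j + 1 =>
    let x := branchLaw r p ε j
    let y := (1 - p) * ((r : ℝ) - 1) * x.2 * x.1 ^ (r - 2)
    (x.1 - ε * y, (1 - ε) * x.2 + ε * y)

variable {V : Type*} {N : ℕ}

/-- The outcome of the coin of the vertex `u` in round `j`. -/
def coin (ω : V × Fin (N + 1) → Bool) (j : ℕ) (u : V) : Prop := ω (u, Fin.ofNat (N + 1) j) = true

/-- The bias of the coins: `p` in the initial round, `ε` in all others. -/
noncomputable def bias (V : Type*) (N : ℕ) (p ε : ℝ) (i : V × Fin (N + 1)) : ℝ :=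
  if i.2 = 0 then p else ε

lemma coin_congr {ω ω' : V × Fin (N + 1) → Bool} {j : ℕ} {u : V}
    (h : ω (u, Fin.ofNat (N + 1) j) = ω' (u, Fin.ofNat (N + 1) j)) :
    coin ω j u ↔ coin ω' j u := by
  unfold coin
  rw [h]

/-- Rounds beyond `N` wrap around modulo `N + 1`, so equality needs `j ≤ N`; the inequality alone
suffices to bound which coins an event uses. -/
lemma val_ofNat_le (N j : ℕ) : (Fin.ofNat (N + 1) j).val ≤ j := Nat.mod_le _ _

lemma val_ofNat_eq {N j : ℕ} (h : j ≤ N) : (Fin.ofNat (N + 1) j).val = j :=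
  Nat.mod_eq_of_lt (by omega)

lemma dependsOn_ind {ι : Type*} {E : (ι → Bool) → Prop} {S : Set ι}
    (h : ∀ ⦃x y⦄, (∀ i ∈ S, x i = y i) → (E x ↔ E y)) : DependsOn (fun ω => ind (E ω)) S := by
  intro x y hxy
  simp only [h hxy]

lemma dependsOn_coin (j : ℕ) (u : V) (f : Prop → Prop) :
    DependsOn (fun ω : V × Fin (N + 1) → Bool => ind (f (coin ω j u)))
      {i | i.1 = u ∧ i.2 = Fin.ofNat (N + 1) j} :=
  dependsOn_ind fun _ _ h => by rw [propext (coin_congr (h _ ⟨rfl, rfl⟩))]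

lemma dependsOn_not_coin_zero (u : V) :
    DependsOn (fun ω : V × Fin (N + 1) → Bool => ind (¬ coin ω 0 u)) {i | i.1 = u ∧ i.2 = 0} :=
  dependsOn_coin 0 u Not

variable (G : SimpleGraph V)

lemma ind_grownVia_succ (X : ℕ → V → Prop) (j : ℕ) (u w : V) :
    ind (grownVia G X (j + 1) u w ∧ ¬ grownVia G X j u w) = ind (X (j + 1) u) * ind (ready G X j u w) := by
  rw [← ind_and]
  congr 1
  simp only [grownVia, ready, eq_iff_iff]
  tauto

lemma dependsOn_grownVia_ball (j : ℕ) (u w : V) (f : Prop → Prop) :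
    DependsOn (fun ω : V × Fin (N + 1) → Bool => ind (f (grownVia G (coin ω) j u w)))
      {i | i.1 ∈ G.branchBall j u w} :=
  dependsOn_ind fun _ _ h => by
    rw [propext (grownVia_congr fun i _ x hx => coin_congr (h (x, _) hx))]

lemma grownVia_congr_round {j : ℕ} {ω ω' : V × Fin (N + 1) → Bool}
    (h : ∀ i : V × Fin (N + 1), i.2.val ≤ j → ω i = ω' i) (u w : V) :
    grownVia G (coin ω) j u w ↔ grownVia G (coin ω') j u w :=
  grownVia_congr fun i hi x _ => coin_congr (h (x, _) ((val_ofNat_le N i).trans hi))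

lemma dependsOn_ready (j : ℕ) (u w : V) :
    DependsOn (fun ω : V × Fin (N + 1) → Bool => ind (ready G (coin ω) j u w))
      {i | i.2.val ≤ j} :=
  dependsOn_ind fun _ _ h => by
    simp only [ready, grownVia_congr_round G h]

lemma dependsOn_triggered_round (j : ℕ) (c u : V) :
    DependsOn (fun ω : V × Fin (N + 1) → Bool => ind (triggered G (coin ω) j c u))
      {i | i.2.val ≤ j} :=
  dependsOn_ind fun _ _ h =>
    triggered_congr (fun i hi x _ => coin_congr (h (x, _) ((val_ofNat_le N i).trans hi)))
      fun i hi => coin_congr (h (u, _) ((val_ofNat_le N (i + 1)).trans hi))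

/-- Only the coins of `u` in rounds `1` to `j` matter; `j ≤ N` ensures that none of these wraps to
the initial coin, which is reserved for another factor. -/
lemma dependsOn_triggered_ball {j : ℕ} (hj : j ≤ N) (c u : V) :
    DependsOn (fun ω : V × Fin (N + 1) → Bool => ind (triggered G (coin ω) j c u))
      {i | i.1 ∈ G.branchBall j c u ∨ (i.1 = u ∧ i.2 ≠ 0)} :=
  dependsOn_ind fun _ _ h =>
    triggered_congr (fun i _ x hx => coin_congr (h (x, _) (Or.inl hx)))
      fun i hi => coin_congr (h (u, _) (Or.inr ⟨rfl, fun h0 => by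
        have := congrArg Fin.val h0
        rw [val_ofNat_eq (by omega)] at this
        simp at this⟩))

lemma dependsOn_whiteWalk (K : ℕ) (c u : V) :
    DependsOn (fun ω : V × Fin (N + 1) → Bool => ind (whiteWalk G (coin ω) N K c u))
      {i | i.1 ∈ G.branchBall (N + K) c u} :=
  dependsOn_ind fun _ _ h => whiteWalk_congr fun _ x hx => coin_congr (h (x, _) hx)

variable [Fintype V] [DecidableEq V] (p ε : ℝ)

lemma coinExp_ind_coin_zero (u : V) :
    coinExp (bias V N p ε) (fun ω => ind (coin ω 0 u)) = p := by
  have := coinExp_coin (bias V N p ε) (u, Fin.ofNat (N + 1) 0) (fun b => ind (b = true))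
  have h0 : Fin.ofNat (N + 1) 0 = 0 := rfl
  simpa [bias, ind, coin, h0] using this

lemma coinExp_ind_not_coin_zero (u : V) :
    coinExp (bias V N p ε) (fun ω => ind (¬ coin ω 0 u)) = 1 - p := by
  simp only [ind_not]
  rw [coinExp_sub, coinExp_const, coinExp_ind_coin_zero]

lemma coinExp_ind_coin_succ {j : ℕ} (hj : j < N) (u : V) :
    coinExp (bias V N p ε) (fun ω => ind (coin ω (j + 1) u)) = ε := by
  have := coinExp_coin (bias V N p ε) (u, Fin.ofNat (N + 1) (j + 1)) (fun b => ind (b = true))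
  have h0 : Fin.ofNat (N + 1) (j + 1) ≠ 0 := fun h => by
    have := congrArg Fin.val h
    rw [val_ofNat_eq (by omega)] at this
    simp at this
  rw [bias, if_neg h0, ind_of rfl, ind_of_not (by simp), mul_one, mul_zero, add_zero] at this
  exact this

/-- The factorisation behind all the probabilities at a vertex: `e` uses the initial coin of `u`,
`h` one branch and the later coins of `u`, and each `f c'` a different branch. Large girth makes
these coin sets disjoint. -/
lemma coinExp_branch {M : ℕ} (hg : ((2 * M + 2 : ℕ) : ℕ∞) < G.egirth) {u c : V} (hc : G.Adj u c)
    (s : Finset V) (hs : ∀ c' ∈ s, G.Adj u c' ∧ c' ≠ c)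
    {e h : (V × Fin (N + 1) → Bool) → ℝ} {f : V → (V × Fin (N + 1) → Bool) → ℝ}
    (he : DependsOn e {i | i.1 = u ∧ i.2 = 0})
    (hh : DependsOn h {i | i.1 ∈ G.branchBall M c u ∨ (i.1 = u ∧ i.2 ≠ 0)})
    (hf : ∀ c' ∈ s, DependsOn (f c') {i | i.1 ∈ G.branchBall M c' u}) :
    coinExp (bias V N p ε) (fun ω => e ω * (h ω * ∏ c' ∈ s, f c' ω)) =
      coinExp (bias V N p ε) e *
        (coinExp (bias V N p ε) h * ∏ c' ∈ s, coinExp (bias V N p ε) (f c')) := by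
  have hg' : ((M + 2 : ℕ) : ℕ∞) < G.egirth := lt_of_le_of_lt (by exact_mod_cast (by omega)) hg
  have hprod := dependsOn_prod s f _ hf
  have hhprod : DependsOn (fun ω => h ω * ∏ c' ∈ s, f c' ω)
      ({i | i.1 ∈ G.branchBall M c u ∨ (i.1 = u ∧ i.2 ≠ 0)} ∪
        ⋃ c' ∈ s, {i : V × Fin (N + 1) | i.1 ∈ G.branchBall M c' u}) := by
    intro x y hxy
    have h1 := hh fun i hi => hxy i (Or.inl hi)
    have h2 := hprod fun i hi => hxy i (Or.inr hi)
    simp only at h2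
    simp only [h1, h2]
  rw [coinExp_mul _ he hhprod, coinExp_mul _ hh hprod, coinExp_prod _ s f _ hf]
  · intro k hk l hl hkl
    refine Set.disjoint_left.2 fun i hi hi' => ?_
    exact Set.disjoint_left.1 (G.disjoint_branchBall hg (hs k hk).1 (hs l hl).1 hkl) hi hi'
  · refine Set.disjoint_iUnion₂_right.2 fun c' hc' => Set.disjoint_left.2 fun i hi hi' => ?_
    rcases hi with hi | ⟨hi, -⟩
    · exact Set.disjoint_left.1 (G.disjoint_branchBall hg hc (hs c' hc').1 (hs c' hc').2.symm) hi hi'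
    · exact G.notMem_branchBall hg' (hs c' hc').1 (hi ▸ hi')
  · refine Set.disjoint_left.2 fun i hi hi' => ?_
    rcases hi' with (hi' | ⟨-, hi'⟩) | hi'
    · exact G.notMem_branchBall hg' hc (hi.1 ▸ hi')
    · exact hi' hi.2
    · obtain ⟨c', hc', hi'⟩ := Set.mem_iUnion₂.1 hi'
      have hi'' : i.1 ∈ G.branchBall M c' u := hi'
      exact G.notMem_branchBall hg' (hs c' hc').1 (hi.1 ▸ hi'')

/-- Readiness after round `j` uses coins of rounds at most `j`, so it is independent of the fresh
coin of round `j + 1`. -/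
lemma coinExp_grownVia_succ {j : ℕ} (hj : j < N) (u w : V) :
    coinExp (bias V N p ε) (fun ω => ind (grownVia G (coin ω) (j + 1) u w ∧ ¬ grownVia G (coin ω) j u w)) =
      ε * coinExp (bias V N p ε) (fun ω => ind (ready G (coin ω) j u w)) := by
  simp only [ind_grownVia_succ]
  have hcoin := dependsOn_coin (N := N) (j + 1) u id
  simp only [id] at hcoin
  rw [coinExp_mul _ hcoin (dependsOn_ready G j u w)]
  · rw [coinExp_ind_coin_succ p ε hj]
  · refine Set.disjoint_left.2 fun i hi hi' => ?_
    have h1 : i.2.val = j + 1 := by rw [hi.2, val_ofNat_eq (by omega)]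
    have h2 : i.2.val ≤ j := hi'
    omega

variable [DecidableRel G.Adj]

/-- The neighbours of `u` other than `w`. -/
def children (u w : V) : Finset V := (G.neighborFinset u).erase w

variable {G}

lemma mem_children {u w c : V} : c ∈ children G u w ↔ G.Adj u c ∧ c ≠ w := by
  simp [children, and_comm]

lemma card_children_of_adj {r : ℕ} (hr : G.IsRegularOfDegree r) {u w : V} (h : G.Adj u w) :
    (children G u w).card = r - 1 := by
  rw [children, Finset.card_erase_of_mem (by simpa using h), SimpleGraph.card_neighborFinset_eq_degree,
    hr u]

/-- Since `u` is not its own neighbour, `w = u` excludes nothing; the branch formulas thereby cover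
whole vertices as well, with `r` children instead of `r - 1`. -/
lemma card_children_self {r : ℕ} (hr : G.IsRegularOfDegree r) (u : V) :
    (children G u u).card = r := by
  rw [children, Finset.erase_eq_of_notMem (by simp), SimpleGraph.card_neighborFinset_eq_degree, hr u]

lemma exists_child_iff (u w : V) {P : Prop} (Q R : V → Prop) :
    (∃ c, (G.Adj u c ∧ c ≠ w) ∧ P ∧ Q c ∧ ∀ c', (G.Adj u c' ∧ c' ≠ w) → c' ≠ c → R c') ↔
      ∃ c ∈ children G u w, P ∧ Q c ∧ ∀ c' ∈ (children G u w).erase c, R c' := by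
  simp only [mem_children, Finset.mem_erase]
  refine exists_congr fun c => and_congr_right fun _ => and_congr_right fun _ =>
    and_congr_right fun _ => forall_congr' fun c' => ?_
  tauto

lemma ind_ready (X : ℕ → V → Prop) (j : ℕ) (u w : V) :
    ind (ready G X j u w) = ∑ c ∈ children G u w, ind (¬ X 0 u) *
      (ind (triggered G X j c u) * ∏ c' ∈ (children G u w).erase c, ind (¬ grownVia G X j c' u)) := by
  rw [ready_iff, exists_child_iff u w (fun c => triggered G X j c u)
    (fun c' => ¬ grownVia G X j c' u), ind_exists_mem_eq]
  · simp only [ind_and, ind_forall_mem]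
  · rintro c hc d hd ⟨-, hc1, -⟩ ⟨-, -, hd2⟩
    by_contra hne
    exact hd2 c (Finset.mem_erase.2 ⟨hne, hc⟩) hc1.1

lemma ind_whiteWalk_succ_le (X : ℕ → V → Prop) (N K : ℕ) (u w : V) :
    ind (whiteWalk G X N (K + 1) u w) ≤ ∑ c ∈ children G u w, ind (¬ X 0 u) *
      (ind (whiteWalk G X N K c u) *
        ∏ c' ∈ (children G u w).erase c, ind (¬ grownVia G X N c' u)) := by
  rw [whiteWalk, exists_child_iff u w (fun c => whiteWalk G X N K c u)
    (fun c' => ¬ grownVia G X N c' u)]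
  refine (ind_exists_mem_le _ _).trans_eq ?_
  simp only [ind_and, ind_forall_mem]

lemma coinExp_ready_of_law {j : ℕ} (hj : j ≤ N) (hg : ((2 * j + 2 : ℕ) : ℕ∞) < G.egirth) {v a : ℝ}
    (hv : ∀ u c, G.Adj u c → coinExp (bias V N p ε) (fun ω => ind (¬ grownVia G (coin ω) j c u)) = v)
    (ha : ∀ u c, G.Adj u c → coinExp (bias V N p ε) (fun ω => ind (triggered G (coin ω) j c u)) = a)
    (u w : V) :
    coinExp (bias V N p ε) (fun ω => ind (ready G (coin ω) j u w)) =
      (children G u w).card * ((1 - p) * (a * v ^ ((children G u w).card - 1))) := by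
  simp only [ind_ready]
  rw [coinExp_sum, Finset.sum_congr rfl, Finset.sum_const, nsmul_eq_mul]
  intro c hc
  have hc' := mem_children.1 hc
  have hs : ∀ c' ∈ (children G u w).erase c, G.Adj u c' ∧ c' ≠ c := fun c' h =>
    ⟨(mem_children.1 (Finset.mem_of_mem_erase h)).1, Finset.ne_of_mem_erase h⟩
  rw [coinExp_branch G p ε hg hc'.1 _ hs (f := fun c' ω => ind (¬ grownVia G (coin ω) j c' u))
    (dependsOn_not_coin_zero u) (dependsOn_triggered_ball G hj c u)
    (fun c' _ => dependsOn_grownVia_ball G j c' u Not), coinExp_ind_not_coin_zero, ha u c hc'.1,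
    Finset.prod_congr rfl fun c' h => hv u c' (hs c' h).1, Finset.prod_const,
    Finset.card_erase_of_mem hc]

/-- The law of the process along a branch of a regular graph of large girth. -/
theorem coinExp_branchLaw {r : ℕ} (hr : G.IsRegularOfDegree r) (hr1 : 1 ≤ r)
    (hg : ((2 * N + 2 : ℕ) : ℕ∞) < G.egirth) {j : ℕ} (hj : j ≤ N) :
    (∀ u c, G.Adj u c → coinExp (bias V N p ε) (fun ω => ind (¬ grownVia G (coin ω) j c u)) =
      (branchLaw r p ε j).1) ∧
    (∀ u c, G.Adj u c → coinExp (bias V N p ε) (fun ω => ind (triggered G (coin ω) j c u)) =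
      (branchLaw r p ε j).2) := by
  induction j with
  | zero =>
    refine ⟨fun u c _ => coinExp_ind_not_coin_zero p ε c, fun u c _ => ?_⟩
    have : ∀ ω : V × Fin (N + 1) → Bool, triggered G (coin ω) 0 c u ↔ coin ω 0 c := fun ω => by
      simp [triggered, grownVia]
    simp only [this]
    exact coinExp_ind_coin_zero p ε c
  | succ j ih =>
    obtain ⟨hv, ha⟩ := ih (by omega)
    have hgj : ((2 * j + 2 : ℕ) : ℕ∞) < G.egirth := lt_of_le_of_lt (by exact_mod_cast (by omega)) hg
    have hnew : ∀ u c, G.Adj u c → coinExp (bias V N p ε)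
        (fun ω => ind (grownVia G (coin ω) (j + 1) c u ∧ ¬ grownVia G (coin ω) j c u)) =
        ε * ((1 - p) * ((r : ℝ) - 1) * (branchLaw r p ε j).2 * (branchLaw r p ε j).1 ^ (r - 2)) := by
      intro u c h
      rw [coinExp_grownVia_succ G p ε (by omega), coinExp_ready_of_law p ε (by omega) hgj hv ha,
        card_children_of_adj hr h.symm, Nat.cast_sub hr1, Nat.sub_sub]
      push_cast
      ring
    constructor
    · intro u c h
      have : ∀ ω : V × Fin (N + 1) → Bool, ind (¬ grownVia G (coin ω) (j + 1) c u) =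
          ind (¬ grownVia G (coin ω) j c u) -
            ind (grownVia G (coin ω) (j + 1) c u ∧ ¬ grownVia G (coin ω) j c u) := by
        intro ω
        have hm : grownVia G (coin ω) j c u → grownVia G (coin ω) (j + 1) c u :=
          grownVia_mono (Nat.le_succ j)
        by_cases h1 : grownVia G (coin ω) j c u
        · simp [ind, h1, hm h1]
        · by_cases h2 : grownVia G (coin ω) (j + 1) c u <;> simp [ind, h1, h2]
      simp only [this]
      rw [coinExp_sub, hv u c h, hnew u c h]
      rfl
    · intro u c h
      have : ∀ ω : V × Fin (N + 1) → Bool, ind (triggered G (coin ω) (j + 1) c u) =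
          ind (grownVia G (coin ω) (j + 1) c u ∧ ¬ grownVia G (coin ω) j c u) +
            ind (triggered G (coin ω) j c u) * ind (¬ coin ω (j + 1) u) := by
        intro ω
        rw [triggered_succ_iff, ← ind_and]
        exact ind_or fun h1 h2 => h1.2 h2.1.1
      simp only [this]
      rw [coinExp_add, hnew u c h, coinExp_mul _ (dependsOn_triggered_round G j c u)
        (dependsOn_coin (j + 1) u Not), ha u c h]
      · simp only [ind_not]
        rw [coinExp_sub, coinExp_const, coinExp_ind_coin_succ p ε (by omega)]
        simp only [branchLaw]
        ring
      · refine Set.disjoint_left.2 fun i hi hi' => ?_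
        have h1 : i.2.val = j + 1 := by rw [hi'.2, val_ofNat_eq (by omega)]
        have h2 : i.2.val ≤ j := hi
        omega

end ProcessLaw

/-! ### The induced forest and the expectation of its size. -/

section ForestBound

variable {V : Type*}

/-- The vertex joins the growth process in round `j`. -/
def born (G : SimpleGraph V) (X : ℕ → V → Prop) : ℕ → V → Prop
  | 0, u => X 0 u
  | j + 1, u => grown G X (j + 1) u ∧ ¬ grown G X j u

/-- Neither the vertex nor any of its neighbours has joined by round `N`. -/
def untouched (G : SimpleGraph V) (X : ℕ → V → Prop) (N : ℕ) (v : V) : Prop :=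
  ¬ grown G X N v ∧ ∀ c, G.Adj v c → ¬ grown G X N c

/-- The vertices that join within `N` rounds, none of whose neighbours joins in the same round,
and the untouched vertices from which no untouched walk of `K` steps starts. -/
def forestSet (G : SimpleGraph V) (X : ℕ → V → Prop) (N K : ℕ) : Set V :=
  {v | (∃ j ∈ Finset.range (N + 1), born G X j v ∧ ∀ c, G.Adj v c → ¬ born G X j c) ∨
    (untouched G X N v ∧ ¬ whiteWalk G X N K v v)}

section Acyclic

variable {G : SimpleGraph V} {X : ℕ → V → Prop} {N K : ℕ}

lemma born.joined {j : ℕ} {v : V} (h : born G X j v) : grown G X j v := by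
  cases j with
  | zero => exact h
  | succ j => exact h.1

lemma born.le_of_grown {i j : ℕ} {v : V} (h : born G X j v) (hi : grown G X i v) : j ≤ i := by
  cases j with
  | zero => exact Nat.zero_le i
  | succ j => exact not_lt.1 fun hij => h.2 (grown_mono (Nat.lt_succ_iff.1 hij) hi)

lemma born.eq {i j : ℕ} {v : V} (h : born G X j v) (h' : born G X i v) : j = i :=
  le_antisymm (h.le_of_grown h'.joined) (h'.le_of_grown h.joined)

lemma born.chosen {j : ℕ} {v : V} (h : born G X (j + 1) v) : X (j + 1) v := by
  rcases h.1 with h' | h'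
  · exact absurd h' h.2
  · exact h'.1

lemma born.existsUnique {j : ℕ} {v : V} (h : born G X (j + 1) v) :
    ∃! c, G.Adj v c ∧ grown G X j c := by
  rcases h.1 with h' | h'
  · exact absurd h' h.2
  · exact h'.2

lemma SimpleGraph.Walk.forall_mem_support_of_propagates {a b : V} (p : G.Walk a b) {S : Set V}
    {P : V → Prop} (hS : ∀ x ∈ p.support, x ∈ S)
    (hP : ∀ x ∈ S, ∀ y ∈ S, G.Adj x y → P x → P y) (ha : P a) : ∀ x ∈ p.support, P x := by
  induction p with
  | nil => simpa using ha
  | @cons a b c h p ih =>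
    have hS' : ∀ x ∈ p.support, x ∈ S := fun x hx => hS x (by simp [hx])
    have hb : P b := hP a (hS a (by simp)) b (hS' b p.start_mem_support) h ha
    intro x hx
    rw [SimpleGraph.Walk.support_cons, List.mem_cons] at hx
    rcases hx with rfl | hx
    · exact ha
    · exact ih hS' hb x hx

/-- An untouched vertex has no joined neighbour, so the cycle is either entirely joined or entirely
untouched. These cases contradict, respectively, the uniqueness of the earlier neighbour of a vertex
born last and the absence of untouched walks of `K` steps. -/
lemma not_isCycle_of_subset_forestSet (hK : ((K : ℕ) : ℕ∞) < G.egirth) {a : V} (c : G.Walk a a)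
    (hS : ∀ x ∈ c.support, x ∈ forestSet G X N K) : ¬ c.IsCycle := by
  classical
  intro hc
  have hlen : K < c.length := by
    have := hK.trans_le (SimpleGraph.egirth_le_length hc)
    exact_mod_cast this
  have hgr : ∀ x, (∃ j ∈ Finset.range (N + 1), born G X j x ∧ ∀ c, G.Adj x c → ¬ born G X j c) →
      grown G X N x := by
    rintro x ⟨j, hj, hb, -⟩
    exact grown_mono (by simpa [Nat.lt_succ_iff] using hj) hb.joined
  by_cases ha : grown G X N a
  · have hall : ∀ x ∈ c.support, grown G X N x := by
      refine c.forall_mem_support_of_propagates hS (fun x hx y hy hxy hgx => ?_) ha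
      rcases hy with hy | hy
      · exact hgr y hy
      · exact absurd hgx (hy.1.2 x hxy.symm)
    have hborn : ∀ x ∈ c.support, ∃ j, born G X j x ∧ ∀ c, G.Adj x c → ¬ born G X j c := by
      intro x hx
      rcases hS x hx with ⟨j, -, h⟩ | h
      · exact ⟨j, h⟩
      · exact absurd (hall x hx) h.1.1
    choose! f hf using hborn
    -- A vertex born last on the cycle: neighbours in the forest are never born in the same round,
    -- so both of its cycle neighbours are strictly older.
    obtain ⟨x, hx, hmax⟩ := Finset.exists_max_image c.support.toFinset f
      ⟨a, by simp⟩
    rw [List.mem_toFinset] at hx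
    have hc' := hc.rotate hx
    have hsub : ∀ y ∈ (c.rotate x hx).support, y ∈ c.support := fun y hy =>
      (SimpleGraph.Walk.mem_support_rotate_iff c x hx).1 hy
    have key : ∀ y ∈ (c.rotate x hx).support, G.Adj x y → f y < f x := by
      intro y hy hxy
      have hy' := hsub y hy
      refine lt_of_le_of_ne (hmax y (by simpa using hy')) fun h => ?_
      exact (hf x hx).2 y hxy (h ▸ (hf y hy').1)
    have h1 := (c.rotate x hx).adj_snd hc'.not_nil
    have h2 := ((c.rotate x hx).adj_penultimate hc'.not_nil).symm
    have m1 := (c.rotate x hx).getVert_mem_support 1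
    have m2 := (c.rotate x hx).getVert_mem_support ((c.rotate x hx).length - 1)
    have k1 := key _ m1 h1
    have k2 := key _ m2 h2
    obtain ⟨j, hj⟩ : ∃ j, f x = j + 1 := ⟨f x - 1, by omega⟩
    have hbx := (hf x hx).1
    rw [hj] at hbx k1 k2
    exact hc'.snd_ne_penultimate (hbx.existsUnique.unique
      ⟨h1, grown_mono (Nat.lt_succ_iff.1 k1) (hf _ (hsub _ m1)).1.joined⟩
      ⟨h2, grown_mono (Nat.lt_succ_iff.1 k2) (hf _ (hsub _ m2)).1.joined⟩)
  · have hall : ∀ x ∈ c.support, ¬ grown G X N x := by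
      refine c.forall_mem_support_of_propagates hS (fun x hx y hy hxy hgx => ?_) ha
      rcases hx with hx | hx
      · exact absurd (hgr x hx) hgx
      · exact hx.1.2 y hxy
    have hunt : ∀ x ∈ c.support, untouched G X N x ∧ ¬ whiteWalk G X N K x x := by
      intro x hx
      rcases hS x hx with h | h
      · exact absurd (hgr x h) (hall x hx)
      · exact h
    -- The cycle has more than `K` edges, so its first `K` steps form a path.
    have hp := hc.isPath_take hlen
    refine (hunt a c.start_mem_support).2 ?_
    have hl : (c.take K).length = K := by
      rw [SimpleGraph.Walk.take_length, min_eq_left hlen.le]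
    rw [← hl]
    refine whiteWalk_of_isPath _ hp ?_ fun x hx => (hunt x ?_).1
    · have := hp.support_nodup
      rw [← SimpleGraph.Walk.cons_tail_support] at this
      exact (List.nodup_cons.1 this).1
    · exact (c.isSubwalk_take K).support_subset hx

lemma isAcyclic_induce_forestSet (hK : ((K : ℕ) : ℕ∞) < G.egirth) :
    (G.induce (forestSet G X N K)).IsAcyclic := by
  intro a c hc
  refine not_isCycle_of_subset_forestSet (X := X) (N := N) hK
    (c.map (SimpleGraph.Embedding.induce _).toHom) ?_
    (hc.map (SimpleGraph.Embedding.induce (G := G) _).injective)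
  intro x hx
  rw [SimpleGraph.Walk.support_map, List.mem_map] at hx
  obtain ⟨y, -, rfl⟩ := hx
  exact y.2

end Acyclic

variable [Fintype V]

lemma card_le_inducedForestNumber (G : SimpleGraph V) (S : Finset V)
    (h : (G.induce (S : Set V)).IsAcyclic) : S.card ≤ inducedForestNumber G := by
  refine le_csSup ⟨Fintype.card V, ?_⟩ ⟨S, rfl, h⟩
  rintro k ⟨T, rfl, -⟩
  exact Finset.card_le_univ T

lemma sum_ind_forestSet_le (G : SimpleGraph V) (X : ℕ → V → Prop) (N K : ℕ)
    (hK : ((K : ℕ) : ℕ∞) < G.egirth) :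
    ∑ v, ind (v ∈ forestSet G X N K) ≤ inducedForestNumber G := by
  classical
  have h1 : ∑ v, ind (v ∈ forestSet G X N K) = ((forestSet G X N K).toFinset.card : ℝ) := by
    rw [Finset.card_eq_sum_ones, Nat.cast_sum, ← Finset.sum_filter_add_sum_filter_not Finset.univ
      (· ∈ forestSet G X N K)]
    have e1 : ∑ v with v ∈ forestSet G X N K, ind (v ∈ forestSet G X N K) =
        ∑ v with v ∈ forestSet G X N K, ((1 : ℕ) : ℝ) :=
      Finset.sum_congr rfl fun v hv => by
        rw [ind_of (Finset.mem_filter.1 hv).2, Nat.cast_one]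
    have e2 : ∑ v with v ∉ forestSet G X N K, ind (v ∈ forestSet G X N K) = 0 :=
      Finset.sum_eq_zero fun v hv => ind_of_not (Finset.mem_filter.1 hv).2
    rw [e1, e2, add_zero]
    refine Finset.sum_congr ?_ fun _ _ => rfl
    ext v
    simp
  rw [h1]
  exact_mod_cast card_le_inducedForestNumber G _ (by
    rw [Set.coe_toFinset]
    exact isAcyclic_induce_forestSet hK)

variable {G : SimpleGraph V} [DecidableRel G.Adj]

/-- Each loss is bounded by an event of easily computed probability: two neighbours born in the same
round `j + 1` must both have been chosen in it, which costs `ε²` per edge and round, and an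
untouched vertex is discarded only if a `whiteWalk` starts there. -/
lemma ind_forestSet_ge (X : ℕ → V → Prop) (N K : ℕ) (v : V) :
    ind (X 0 v ∧ ∀ c ∈ G.neighborFinset v, ¬ X 0 c) +
      ∑ j ∈ Finset.range N, (ind (grownVia G X (j + 1) v v ∧ ¬ grownVia G X j v v) -
        ∑ c ∈ G.neighborFinset v, ind (X (j + 1) v) * ind (X (j + 1) c)) +
      (ind (¬ X 0 v ∧ ∀ c ∈ G.neighborFinset v, ¬ grownVia G X N c v) -
        ind (whiteWalk G X N K v v)) ≤ ind (v ∈ forestSet G X N K) := by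
  have hmem : ∀ c, c ∈ G.neighborFinset v ↔ G.Adj v c := by simp
  have h0 : ind (v ∈ forestSet G X N K) =
      ind (∃ j ∈ Finset.range (N + 1), born G X j v ∧ ∀ c, G.Adj v c → ¬ born G X j c) +
        ind (untouched G X N v ∧ ¬ whiteWalk G X N K v v) := by
    refine ind_or ?_
    rintro ⟨j, hj, hb, -⟩ h
    exact h.1.1 (grown_mono (by simpa [Nat.lt_succ_iff] using hj) hb.joined)
  rw [h0, ind_exists_mem_eq, Finset.sum_range_succ']
  · refine add_le_add ?_ ?_
    · rw [add_comm]
      refine add_le_add (Finset.sum_le_sum fun j _ => ?_) (le_of_eq ?_)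
      · have hb : (grownVia G X (j + 1) v v ∧ ¬ grownVia G X j v v) ↔ born G X (j + 1) v := by
          rw [← grown_iff_grownVia_self, ← grown_iff_grownVia_self]
          rfl
        rw [hb]
        by_cases hv : born G X (j + 1) v
        · rw [ind_of hv]
          by_cases hc : ∀ c, G.Adj v c → ¬ born G X (j + 1) c
          · have h1 : ind (born G X (j + 1) v ∧ ∀ c, G.Adj v c → ¬ born G X (j + 1) c) = 1 :=
              ind_of ⟨hv, hc⟩
            have : 0 ≤ ∑ c ∈ G.neighborFinset v, ind (X (j + 1) v) * ind (X (j + 1) c) :=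
              Finset.sum_nonneg fun c _ => mul_nonneg (ind_nonneg _) (ind_nonneg _)
            linarith
          · push Not at hc
            obtain ⟨c, hvc, hc⟩ := hc
            have h1 : ind (X (j + 1) v) * ind (X (j + 1) c) = 1 := by
              rw [ind_of hv.chosen, ind_of hc.chosen, one_mul]
            have := Finset.single_le_sum
              (f := fun c => ind (X (j + 1) v) * ind (X (j + 1) c))
              (fun c _ => mul_nonneg (ind_nonneg _) (ind_nonneg _)) ((hmem c).2 hvc)
            simp only [h1] at this
            linarith [ind_nonneg (born G X (j + 1) v ∧ ∀ c, G.Adj v c → ¬ born G X (j + 1) c)]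
        · rw [ind_of_not hv]
          have : 0 ≤ ∑ c ∈ G.neighborFinset v, ind (X (j + 1) v) * ind (X (j + 1) c) :=
            Finset.sum_nonneg fun c _ => mul_nonneg (ind_nonneg _) (ind_nonneg _)
          linarith [ind_nonneg (born G X (j + 1) v ∧ ∀ c, G.Adj v c → ¬ born G X (j + 1) c)]
      · simp only [hmem]
        rfl
    · simp only [hmem]
      rw [← not_grown_nbhd_iff]
      change ind (untouched G X N v) - _ ≤ _
      rw [ind_and, ind_not]
      have h1 := ind_le_one (untouched G X N v)
      have h2 := ind_nonneg (whiteWalk G X N K v v)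
      nlinarith
  · rintro i - j - ⟨hi, -⟩ ⟨hj, -⟩
    exact hi.eq hj

variable [DecidableEq V] {N : ℕ} (p ε : ℝ)

lemma coinExp_isolated_seed {r : ℕ} (hr : G.IsRegularOfDegree r) (v : V) :
    coinExp (bias V N p ε) (fun ω => ind (coin ω 0 v ∧ ∀ c ∈ G.neighborFinset v, ¬ coin ω 0 c)) =
      p * (1 - p) ^ r := by
  simp only [ind_and, ind_forall_mem]
  have hd := dependsOn_prod (G.neighborFinset v)
    (fun c (ω : V × Fin (N + 1) → Bool) => ind (¬ coin ω 0 c)) _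
    fun c _ => dependsOn_coin 0 c Not
  have hv := dependsOn_coin (N := N) 0 v id
  simp only [id] at hv
  rw [coinExp_mul _ hv hd, coinExp_ind_coin_zero, coinExp_prod _ (G.neighborFinset v)
    (fun c (ω : V × Fin (N + 1) → Bool) => ind (¬ coin ω 0 c)) _
    (fun c _ => dependsOn_coin 0 c Not)]
  · simp only [coinExp_ind_not_coin_zero, Finset.prod_const,
      SimpleGraph.card_neighborFinset_eq_degree, hr v]
  · intro k _ l _ hkl
    exact Set.disjoint_left.2 fun i hi hi' => hkl (hi.1.symm.trans hi'.1)
  · refine Set.disjoint_iUnion₂_right.2 fun c hc => Set.disjoint_left.2 fun i hi hi' => ?_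
    rw [SimpleGraph.mem_neighborFinset] at hc
    exact hc.ne (hi.1.symm.trans hi'.1)

lemma coinExp_conflict {j : ℕ} (hj : j < N) {v c : V} (h : v ≠ c) :
    coinExp (bias V N p ε) (fun ω => ind (coin ω (j + 1) v) * ind (coin ω (j + 1) c)) = ε * ε := by
  have hv := dependsOn_coin (N := N) (j + 1) v id
  have hc := dependsOn_coin (N := N) (j + 1) c id
  simp only [id] at hv hc
  rw [coinExp_mul _ hv hc, coinExp_ind_coin_succ p ε hj, coinExp_ind_coin_succ p ε hj]
  exact Set.disjoint_left.2 fun i hi hi' => h (hi.1.symm.trans hi'.1)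

lemma coinExp_untouched {r : ℕ} (hr : G.IsRegularOfDegree r) (hr1 : 1 ≤ r)
    (hg : ((2 * N + 2 : ℕ) : ℕ∞) < G.egirth) (v : V) :
    coinExp (bias V N p ε)
      (fun ω => ind (¬ coin ω 0 v ∧ ∀ c ∈ G.neighborFinset v, ¬ grownVia G (coin ω) N c v)) =
      (1 - p) * (branchLaw r p ε N).1 ^ r := by
  have hlaw := (coinExp_branchLaw p ε hr hr1 hg le_rfl).1
  have hcard : (G.neighborFinset v).card = r := by
    rw [SimpleGraph.card_neighborFinset_eq_degree, hr v]
  obtain ⟨c, hc⟩ : (G.neighborFinset v).Nonempty := Finset.card_pos.1 (by omega)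
  have hc' := (G.mem_neighborFinset v c).1 hc
  have hs : ∀ c' ∈ (G.neighborFinset v).erase c, G.Adj v c' ∧ c' ≠ c := fun c' h =>
    ⟨(G.mem_neighborFinset v c').1 (Finset.mem_of_mem_erase h), Finset.ne_of_mem_erase h⟩
  have hdep : DependsOn (fun ω : V × Fin (N + 1) → Bool => ind (¬ grownVia G (coin ω) N c v))
      {i | i.1 ∈ G.branchBall N c v ∨ (i.1 = v ∧ i.2 ≠ 0)} := fun x y hxy =>
    dependsOn_grownVia_ball G N c v Not fun i hi => hxy i (Or.inl hi)
  simp only [ind_and, ind_forall_mem, ← Finset.mul_prod_erase _ _ hc]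
  rw [coinExp_branch G p ε hg hc' _ hs (f := fun c' ω => ind (¬ grownVia G (coin ω) N c' v))
    (dependsOn_not_coin_zero v) hdep (fun c' _ => dependsOn_grownVia_ball G N c' v Not),
    coinExp_ind_not_coin_zero, hlaw v c hc', Finset.prod_congr rfl fun c' h => hlaw v c' (hs c' h).1,
    Finset.prod_const, Finset.card_erase_of_mem hc, hcard, ← pow_succ', Nat.sub_add_cancel hr1]

lemma coinExp_whiteWalk_succ_le {r : ℕ} (hr : G.IsRegularOfDegree r) (hr1 : 1 ≤ r)
    (hp0 : 0 ≤ p) (hp1 : p ≤ 1) (hε0 : 0 ≤ ε) (hε1 : ε ≤ 1) {K : ℕ}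
    (hg : ((2 * (N + K) + 2 : ℕ) : ℕ∞) < G.egirth) (hv0 : 0 ≤ (branchLaw r p ε N).1) {a : ℝ}
    (ha : ∀ u c, G.Adj u c →
      coinExp (bias V N p ε) (fun ω => ind (whiteWalk G (coin ω) N K c u)) ≤ a) (u w : V) :
    coinExp (bias V N p ε) (fun ω => ind (whiteWalk G (coin ω) N (K + 1) u w)) ≤
      (children G u w).card * ((1 - p) * (a * (branchLaw r p ε N).1 ^ ((children G u w).card - 1))) := by
  have hgN : ((2 * N + 2 : ℕ) : ℕ∞) < G.egirth := lt_of_le_of_lt (by exact_mod_cast (by omega)) hg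
  have hlaw := (coinExp_branchLaw p ε hr hr1 hgN le_rfl).1
  refine (coinExp_mono _ ?_ ?_ fun ω => ind_whiteWalk_succ_le (coin ω) N K u w).trans ?_
  · intro i
    unfold bias
    split_ifs <;> assumption
  · intro i
    unfold bias
    split_ifs <;> assumption
  rw [coinExp_sum, ← nsmul_eq_mul, ← Finset.sum_const]
  refine Finset.sum_le_sum fun c hc => ?_
  have hc' := mem_children.1 hc
  have hs : ∀ c' ∈ (children G u w).erase c, G.Adj u c' ∧ c' ≠ c := fun c' h =>
    ⟨(mem_children.1 (Finset.mem_of_mem_erase h)).1, Finset.ne_of_mem_erase h⟩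
  have hdep : DependsOn (fun ω : V × Fin (N + 1) → Bool => ind (whiteWalk G (coin ω) N K c u))
      {i | i.1 ∈ G.branchBall (N + K) c u ∨ (i.1 = u ∧ i.2 ≠ 0)} := fun x y hxy =>
    dependsOn_whiteWalk G K c u fun i hi => hxy i (Or.inl hi)
  have hdep' : ∀ c', DependsOn (fun ω : V × Fin (N + 1) → Bool => ind (¬ grownVia G (coin ω) N c' u))
      {i | i.1 ∈ G.branchBall (N + K) c' u} := fun c' x y hxy =>
    dependsOn_grownVia_ball G N c' u Not fun i hi =>
      hxy i (G.branchBall_mono (Nat.le_add_right N K) c' u hi)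
  rw [coinExp_branch G p ε hg hc'.1 _ hs (f := fun c' ω => ind (¬ grownVia G (coin ω) N c' u))
    (dependsOn_not_coin_zero u) hdep (fun c' _ => hdep' c'),
    coinExp_ind_not_coin_zero, Finset.prod_congr rfl fun c' h => hlaw u c' (hs c' h).1,
    Finset.prod_const, Finset.card_erase_of_mem hc]
  have := ha u c hc'.1
  have h1p : 0 ≤ 1 - p := by linarith
  gcongr

/-- A first-moment bound for a branching process: each step multiplies the expected number of walks
by at most the mean offspring `(1 - p)(r - 1)v^(r - 2)`. -/
lemma coinExp_whiteWalk_le {r : ℕ} (hr : G.IsRegularOfDegree r) (hr1 : 1 ≤ r)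
    (hp0 : 0 ≤ p) (hp1 : p ≤ 1) (hε0 : 0 ≤ ε) (hε1 : ε ≤ 1) {K : ℕ}
    (hg : ((2 * (N + K) + 2 : ℕ) : ℕ∞) < G.egirth) (hv0 : 0 ≤ (branchLaw r p ε N).1)
    {u c : V} (h : G.Adj u c) :
    coinExp (bias V N p ε) (fun ω => ind (whiteWalk G (coin ω) N K c u)) ≤
      ((1 - p) * ((r : ℝ) - 1) * (branchLaw r p ε N).1 ^ (r - 2)) ^ K := by
  induction K generalizing u c with
  | zero =>
    have : ∀ ω : V × Fin (N + 1) → Bool, ind (whiteWalk G (coin ω) N 0 c u) = 1 :=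
      fun ω => ind_of trivial
    simp only [this, coinExp_const, pow_zero, le_refl]
  | succ K ih =>
    have hg' : ((2 * (N + K) + 2 : ℕ) : ℕ∞) < G.egirth :=
      lt_of_le_of_lt (by exact_mod_cast (by omega)) hg
    refine (coinExp_whiteWalk_succ_le p ε hr hr1 hp0 hp1 hε0 hε1 hg' hv0
      (fun u c h => ih hg' h) c u).trans_eq ?_
    rw [card_children_of_adj hr h.symm, Nat.cast_sub hr1, Nat.sub_sub]
    push_cast
    ring

/-- The size of the induced forest found by the growth process, in a graph of large girth. -/
theorem le_inducedForestNumber {r : ℕ} (hr : G.IsRegularOfDegree r) (hr1 : 1 ≤ r)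
    (hp0 : 0 ≤ p) (hp1 : p ≤ 1) (hε0 : 0 ≤ ε) (hε1 : ε ≤ 1) {K : ℕ}
    (hg : ((2 * (N + K) + 2 : ℕ) : ℕ∞) < G.egirth) (hv0 : 0 ≤ (branchLaw r p ε N).1) :
    (Fintype.card V : ℝ) * (p * (1 - p) ^ r +
      ∑ j ∈ Finset.range N, (ε * (r * ((1 - p) * ((branchLaw r p ε j).2 *
        (branchLaw r p ε j).1 ^ (r - 1)))) - r * (ε * ε)) +
      ((1 - p) * (branchLaw r p ε N).1 ^ r -
        r * ((1 - p) * (((1 - p) * ((r : ℝ) - 1) * (branchLaw r p ε N).1 ^ (r - 2)) ^ K *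
          (branchLaw r p ε N).1 ^ (r - 1))))) ≤ inducedForestNumber G := by
  have hgN : ((2 * N + 2 : ℕ) : ℕ∞) < G.egirth := lt_of_le_of_lt (by exact_mod_cast (by omega)) hg
  -- The forest is taken with walks of `K + 1` steps: the first step from `v` has `r` choices, and
  -- the other `K` follow the branch estimate.
  have hK : ((K + 1 : ℕ) : ℕ∞) < G.egirth := lt_of_le_of_lt (by exact_mod_cast (by omega)) hg
  have hb0 : ∀ i, 0 ≤ bias V N p ε i := fun i => by
    unfold bias
    split_ifs <;> assumption
  have hb1 : ∀ i, bias V N p ε i ≤ 1 := fun i => by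
    unfold bias
    split_ifs <;> assumption
  obtain ⟨ω, hω⟩ := exists_coinExp_le (bias V N p ε) hb0 hb1
    (fun ω => ∑ v, ind (v ∈ forestSet G (coin ω) N (K + 1)))
  refine le_trans (le_trans ?_ hω) (sum_ind_forestSet_le G (coin ω) N (K + 1) hK)
  rw [coinExp_sum, ← nsmul_eq_mul, ← Finset.card_univ, ← Finset.sum_const]
  refine Finset.sum_le_sum fun v _ => ?_
  refine le_trans ?_ (coinExp_mono _ hb0 hb1 fun ω => ind_forestSet_ge (coin ω) N (K + 1) v)
  rw [coinExp_add, coinExp_add, coinExp_sub, coinExp_sum, coinExp_isolated_seed p ε hr,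
    coinExp_untouched p ε hr hr1 hgN]
  have hw := coinExp_whiteWalk_succ_le p ε hr hr1 hp0 hp1 hε0 hε1 hg hv0
    (fun u c h => coinExp_whiteWalk_le p ε hr hr1 hp0 hp1 hε0 hε1 hg hv0 h) v v
  rw [card_children_self hr] at hw
  refine add_le_add (add_le_add le_rfl (Finset.sum_le_sum fun j hj => le_of_eq ?_))
    (sub_le_sub_left hw _)
  have hj := Finset.mem_range.1 hj
  have hgj : ((2 * j + 2 : ℕ) : ℕ∞) < G.egirth := lt_of_le_of_lt (by exact_mod_cast (by omega)) hg
  have hlaw := coinExp_branchLaw p ε hr hr1 hgN hj.le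
  rw [coinExp_sub, coinExp_sum, coinExp_grownVia_succ G p ε hj,
    coinExp_ready_of_law p ε hj.le hgj hlaw.1 hlaw.2, card_children_self hr,
    Finset.sum_congr rfl fun c hc =>
      coinExp_conflict p ε hj ((G.mem_neighborFinset v c).1 hc).ne, Finset.sum_const,
    SimpleGraph.card_neighborFinset_eq_degree, hr v, nsmul_eq_mul]

end ForestBound

/-! ### The first integral of the limiting flow and its zero. -/

section Potential

/-- A primitive of `v ↦ v ^ (-(r - 2))` on the positive half-line. -/
noncomputable def powPrimitive (r : ℕ) (v : ℝ) : ℝ :=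
  if r = 3 then Real.log v else -(v ^ (r - 3))⁻¹ / ((r : ℝ) - 3)

/-- The first integral of the reduced system: the trigger probability as a function of the
survival probability `v` of a branch. -/
noncomputable def potential (r : ℕ) (p v : ℝ) : ℝ :=
  p + (powPrimitive r v - powPrimitive r (1 - p)) / ((1 - p) * ((r : ℝ) - 1)) - (v - (1 - p))

/-- The slope of `potential`. -/
noncomputable def potentialSlope (r : ℕ) (p v : ℝ) : ℝ :=
  (v ^ (r - 2))⁻¹ / ((1 - p) * ((r : ℝ) - 1)) - 1

lemma hasDerivAt_powPrimitive {r : ℕ} (hr : 3 ≤ r) {v : ℝ} (hv : 0 < v) :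
    HasDerivAt (powPrimitive r) ((v ^ (r - 2))⁻¹) v := by
  unfold powPrimitive
  rcases hr.eq_or_lt with rfl | hr
  · simpa using Real.hasDerivAt_log hv.ne'
  · simp only [if_neg hr.ne']
    obtain ⟨k, rfl⟩ : ∃ k, r = k + 4 := ⟨r - 4, by omega⟩
    have h := (((hasDerivAt_pow (k + 1) v).inv (by positivity)).neg).div_const
      (((k + 4 : ℕ) : ℝ) - 3)
    have e1 : k + 4 - 3 = k + 1 := by omega
    have e2 : k + 4 - 2 = k + 2 := by omega
    rw [e1, e2]
    refine HasDerivAt.congr_deriv h ?_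
    have hk : (k : ℝ) + 1 ≠ 0 := by positivity
    have hk' : ((k + 4 : ℕ) : ℝ) - 3 = k + 1 := by push_cast; ring
    rw [hk']
    rw [Nat.add_sub_cancel]
    push_cast
    field_simp
    ring

variable {r : ℕ} {p : ℝ}

lemma denom_pos (hr : 3 ≤ r) (hp1 : p < 1) : 0 < (1 - p) * ((r : ℝ) - 1) := by
  have : (3 : ℝ) ≤ r := by exact_mod_cast hr
  have : 0 < 1 - p := by linarith
  have : (0 : ℝ) < r - 1 := by linarith
  positivity

lemma hasDerivAt_potential (hr : 3 ≤ r) {v : ℝ} (hv : 0 < v) :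
    HasDerivAt (potential r p) (potentialSlope r p v) v :=
  ((((hasDerivAt_powPrimitive hr hv).sub_const _).div_const _).const_add p).sub
    ((hasDerivAt_id v).sub_const _)

lemma continuousOn_potential (hr : 3 ≤ r) : ContinuousOn (potential r p) (Ioi 0) :=
  fun _ hv => (hasDerivAt_potential hr hv).continuousAt.continuousWithinAt

lemma potential_init : potential r p (1 - p) = p := by simp [potential]

lemma potentialSlope_anti (hr : 3 ≤ r) (hp1 : p < 1) {x y : ℝ} (hx : 0 < x) (hxy : x ≤ y) :
    potentialSlope r p y ≤ potentialSlope r p x := by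
  have := denom_pos hr hp1
  unfold potentialSlope
  gcongr

/-- Concavity: the slope is antitone, so the graph lies below each tangent. All sign information on
the potential comes from this inequality. -/
lemma potential_le_tangent (hr : 3 ≤ r) (hp1 : p < 1) {x y : ℝ} (hx : 0 < x) (hy : 0 < y) :
    potential r p y ≤ potential r p x + potentialSlope r p x * (y - x) := by
  rcases lt_trichotomy x y with h | rfl | h
  · obtain ⟨c, hc, hc'⟩ := exists_hasDerivAt_eq_slope (potential r p) (potentialSlope r p) h
      ((continuousOn_potential hr).mono fun z hz => hx.trans_le hz.1)
      fun z hz => hasDerivAt_potential hr (hx.trans hz.1)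
    rw [eq_div_iff (by linarith)] at hc'
    have := potentialSlope_anti hr hp1 hx hc.1.le
    nlinarith
  · simp
  · obtain ⟨c, hc, hc'⟩ := exists_hasDerivAt_eq_slope (potential r p) (potentialSlope r p) h
      ((continuousOn_potential hr).mono fun z hz => hy.trans_le hz.1)
      fun z hz => hasDerivAt_potential hr (hy.trans hz.1)
    rw [eq_div_iff (by linarith)] at hc'
    have := potentialSlope_anti hr hp1 (hy.trans hc.1) hc.2.le
    nlinarith

lemma tendsto_powPrimitive (hr : 3 ≤ r) : Tendsto (powPrimitive r) (𝓝[>] 0) atBot := by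
  unfold powPrimitive
  rcases hr.eq_or_lt with rfl | hr
  · simpa using Real.tendsto_log_nhdsGT_zero
  · simp only [if_neg hr.ne']
    have hk : (0 : ℝ) < r - 3 := by
      have : (3 : ℝ) < r := by exact_mod_cast hr
      linarith
    have h1 : Tendsto (fun v : ℝ => v ^ (r - 3)) (𝓝[>] 0) (𝓝[>] 0) := by
      refine tendsto_nhdsWithin_iff.2 ⟨?_, ?_⟩
      · exact ((continuous_pow (r - 3)).tendsto' 0 0
          (zero_pow (by omega))).mono_left nhdsWithin_le_nhds
      · filter_upwards [self_mem_nhdsWithin] with v hv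
        exact pow_pos (show (0 : ℝ) < v from hv) _
    exact (tendsto_neg_atTop_atBot.comp (tendsto_inv_nhdsGT_zero.comp h1)).atBot_div_const hk

lemma exists_potential_eq_zero (hr : 3 ≤ r) (hp0 : 0 < p) (hp1 : p < 1) :
    ∃ z, 0 < z ∧ z < 1 - p ∧ potential r p z = 0 := by
  have hd := denom_pos hr hp1
  -- The primitive tends to `-∞` at `0`. Making its contribution at most `-2` outweighs the
  -- remaining terms, which sum to at most `1`.
  obtain ⟨x, hx, hx0, hx1⟩ : ∃ x, powPrimitive r x ≤
      powPrimitive r (1 - p) - 2 * ((1 - p) * ((r : ℝ) - 1)) ∧ 0 < x ∧ x < 1 - p := by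
    have h1 := (tendsto_powPrimitive hr).eventually_le_atBot
      (powPrimitive r (1 - p) - 2 * ((1 - p) * ((r : ℝ) - 1)))
    have h2 : ∀ᶠ x in 𝓝[>] (0 : ℝ), x < 1 - p :=
      nhdsWithin_le_nhds (Iio_mem_nhds (by linarith))
    have h3 : ∀ᶠ x in 𝓝[>] (0 : ℝ), 0 < x := self_mem_nhdsWithin
    obtain ⟨x, hx⟩ := (h1.and (h3.and h2)).exists
    exact ⟨x, hx.1, hx.2⟩
  have hneg : potential r p x < 0 := by
    have : (powPrimitive r x - powPrimitive r (1 - p)) / ((1 - p) * ((r : ℝ) - 1)) ≤ -2 := by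
      rw [div_le_iff₀ hd]
      linarith
    unfold potential
    linarith
  obtain ⟨z, hz, hz0⟩ := intermediate_value_Ioo hx1.le
    ((continuousOn_potential (p := p) hr).mono fun z hz => hx0.trans_le hz.1)
    (show (0 : ℝ) ∈ Ioo _ _ from ⟨hneg, by rwa [potential_init]⟩)
  exact ⟨z, hx0.trans hz.1, hz.2, hz0⟩

variable {z : ℝ}

/-- The tangent at `z` lies above the graph, so it must climb from `0` to at least `p > 0` at `1 -
p`. -/
lemma potentialSlope_pos_of_root (hr : 3 ≤ r) (hp0 : 0 < p) (hp1 : p < 1) (hz0 : 0 < z)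
    (hz1 : z < 1 - p) (hz : potential r p z = 0) : 0 < potentialSlope r p z := by
  have := potential_le_tangent (r := r) hr hp1 hz0 (show 0 < 1 - p by linarith)
  rw [potential_init, hz, zero_add] at this
  exact pos_of_mul_pos_left (hp0.trans_le this) (by linarith)

lemma potential_pos (hr : 3 ≤ r) (hp0 : 0 < p) (hp1 : p < 1) (hz0 : 0 < z)
    (hz : potential r p z = 0) {y : ℝ} (hzy : z < y) (hy : y ≤ 1 - p) :
    0 < potential r p y := by
  have hy0 := hz0.trans hzy
  by_contra! h
  have h1 := potential_le_tangent (r := r) hr hp1 hy0 hz0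
  have h2 := potential_le_tangent (r := r) hr hp1 hy0 (show 0 < 1 - p by linarith)
  rw [hz] at h1
  rw [potential_init] at h2
  have h3 : potentialSlope r p y ≤ 0 := by
    by_contra! h'
    nlinarith
  nlinarith

lemma potential_neg (hr : 3 ≤ r) (hp0 : 0 < p) (hp1 : p < 1) (hz0 : 0 < z) (hz1 : z < 1 - p)
    (hz : potential r p z = 0) {y : ℝ} (hy : 0 < y) (hyz : y < z) : potential r p y < 0 := by
  have h1 := potential_le_tangent (r := r) hr hp1 hz0 hy
  have h2 := potentialSlope_pos_of_root hr hp0 hp1 hz0 hz1 hz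
  rw [hz] at h1
  nlinarith

/-- Positivity of the slope at `z`, rewritten: the untouched part left at the end is subcritical. -/
lemma branching_lt_one_of_root (hr : 3 ≤ r) (hp0 : 0 < p) (hp1 : p < 1) (hz0 : 0 < z)
    (hz1 : z < 1 - p) (hz : potential r p z = 0) :
    (1 - p) * ((r : ℝ) - 1) * z ^ (r - 2) < 1 := by
  have h := potentialSlope_pos_of_root hr hp0 hp1 hz0 hz1 hz
  have hd := denom_pos hr hp1
  unfold potentialSlope at h
  have hz' : 0 < z ^ (r - 2) := by positivity
  have h2 : 1 < (z ^ (r - 2))⁻¹ / ((1 - p) * ((r : ℝ) - 1)) := by linarith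
  rw [lt_div_iff₀ hd, one_mul, lt_inv_comm₀ hd hz'] at h2
  rwa [← lt_inv_mul_iff₀ hd, mul_one]

/-- The constant determined by the zero `z` of the potential. -/
noncomputable def forestValue (r : ℕ) (p z : ℝ) : ℝ :=
  p * (1 - p) ^ r + r / (2 * ((r : ℝ) - 1)) * ((1 - p) ^ 2 - z ^ 2) + (1 - p) * z ^ r

end Potential

/-! ### Discrete recursion compared with the potential, and choice of parameters. -/

section BranchLaw

variable {r : ℕ} {p ε : ℝ}

lemma branchLaw_fst_succ (j : ℕ) : (branchLaw r p ε (j + 1)).1 = (branchLaw r p ε j).1 -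
    ε * ((1 - p) * ((r : ℝ) - 1) * (branchLaw r p ε j).2 * (branchLaw r p ε j).1 ^ (r - 2)) := rfl

lemma branchLaw_snd_succ (j : ℕ) : (branchLaw r p ε (j + 1)).2 = (1 - ε) * (branchLaw r p ε j).2 +
    ε * ((1 - p) * ((r : ℝ) - 1) * (branchLaw r p ε j).2 * (branchLaw r p ε j).1 ^ (r - 2)) := rfl

/-- A step moves `(v, a)` along the direction of slope `potentialSlope v`, shifted up by the defect
`a - potential v`; by concavity the potential lies below that line, so the point remains above the
curve. The bound on `ε * r` keeps both coordinates positive. -/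
lemma branchLaw_bounds (hr : 3 ≤ r) (hp0 : 0 < p) (hp1 : p < 1) (hε0 : 0 < ε)
    (hε : ε * r ≤ 1 / 2) (j : ℕ) :
    0 < (branchLaw r p ε j).1 ∧ (branchLaw r p ε j).1 ≤ 1 - p ∧ 0 < (branchLaw r p ε j).2 ∧
      (branchLaw r p ε j).1 + (branchLaw r p ε j).2 ≤ 1 ∧
      (branchLaw r p ε (j + 1)).1 ≤ (branchLaw r p ε j).1 ∧
      potential r p (branchLaw r p ε j).1 ≤ (branchLaw r p ε j).2 := by
  have hr' : (3 : ℝ) ≤ r := by exact_mod_cast hr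
  have hd := denom_pos hr hp1
  have hstep : ∀ j, 0 < (branchLaw r p ε j).1 → 0 < (branchLaw r p ε j).2 →
      (branchLaw r p ε (j + 1)).1 ≤ (branchLaw r p ε j).1 := by
    intro j h1 h2
    rw [branchLaw_fst_succ]
    have : 0 ≤ ε * ((1 - p) * ((r : ℝ) - 1) * (branchLaw r p ε j).2 *
      (branchLaw r p ε j).1 ^ (r - 2)) := by positivity
    linarith
  induction j with
  | zero =>
    have h1 : 0 < (branchLaw r p ε 0).1 := by simp only [branchLaw]; linarith
    have h2 : 0 < (branchLaw r p ε 0).2 := hp0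
    refine ⟨h1, le_rfl, h2, by simp [branchLaw], hstep 0 h1 h2, ?_⟩
    simp only [branchLaw]
    rw [potential_init]
  | succ j ih =>
    obtain ⟨h1, h1', h2, h3, h4, h5⟩ := ih
    have e1 := branchLaw_fst_succ (r := r) (p := p) (ε := ε) j
    have e2 := branchLaw_snd_succ (r := r) (p := p) (ε := ε) j
    set v := (branchLaw r p ε j).1
    set a := (branchLaw r p ε j).2
    set v' := (branchLaw r p ε (j + 1)).1
    set a' := (branchLaw r p ε (j + 1)).2
    have hε1 : ε ≤ 1 / 6 := by nlinarith
    have hv' : 0 < v' := by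
      have hpow : v ^ (r - 2) ≤ v := by
        calc v ^ (r - 2) ≤ v ^ 1 := pow_le_pow_of_le_one h1.le (by linarith) (by omega)
          _ = v := pow_one v
      have hb : (1 - p) * ((r : ℝ) - 1) * a * v ^ (r - 2) ≤ r * v := by
        have ha1 : a ≤ 1 := by linarith
        calc (1 - p) * ((r : ℝ) - 1) * a * v ^ (r - 2) ≤ (1 * r) * 1 * v := by
              gcongr <;> linarith
          _ = r * v := by ring
      have : ε * ((1 - p) * ((r : ℝ) - 1) * a * v ^ (r - 2)) ≤ ε * (r * v) := by gcongr
      nlinarith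
    have ha' : 0 < a' := by
      rw [e2]
      have : 0 < (1 - ε) * a := mul_pos (by linarith) h2
      positivity
    refine ⟨hv', h4.trans h1', ha', ?_, hstep (j + 1) hv' ha', ?_⟩
    · rw [e1, e2]
      nlinarith
    · refine (potential_le_tangent hr hp1 h1 hv').trans ?_
      have key : potentialSlope r p v * (v' - v) = a' - a := by
        rw [e1, e2]
        unfold potentialSlope
        have : v ^ (r - 2) ≠ 0 := by positivity
        have hd1 : 1 - p ≠ 0 := by linarith
        have hd2 : (r : ℝ) - 1 ≠ 0 := by linarith
        field_simp
        ring
      rw [key]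
      linarith

/-- Each summand equals `r/(r-1) · v(v - v')`, and `2v(v - v') = v² - v'² + (v - v')²`; dropping the
last square leaves a telescoping sum. -/
lemma sum_branchLaw_ge (hr : 3 ≤ r) (N : ℕ) :
    r / (2 * ((r : ℝ) - 1)) * ((1 - p) ^ 2 - (branchLaw r p ε N).1 ^ 2) ≤
      ∑ j ∈ Finset.range N, ε * (r * ((1 - p) * ((branchLaw r p ε j).2 *
        (branchLaw r p ε j).1 ^ (r - 1)))) := by
  have hr' : (3 : ℝ) ≤ r := by exact_mod_cast hr
  have hr1 : (0 : ℝ) < r - 1 := by linarith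
  induction N with
  | zero => simp [branchLaw]
  | succ N ih =>
    rw [Finset.sum_range_succ]
    have e1 := branchLaw_fst_succ (r := r) (p := p) (ε := ε) N
    have hpow : (branchLaw r p ε N).1 ^ (r - 1) =
        (branchLaw r p ε N).1 ^ (r - 2) * (branchLaw r p ε N).1 := by
      rw [← pow_succ]
      congr 1
      omega
    have e2 : ε * (r * ((1 - p) * ((branchLaw r p ε N).2 * (branchLaw r p ε N).1 ^ (r - 1)))) =
        r / ((r : ℝ) - 1) * ((branchLaw r p ε N).1 *
          ((branchLaw r p ε N).1 - (branchLaw r p ε (N + 1)).1)) := by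
      rw [e1, hpow]
      field_simp
      ring
    rw [e2]
    set v := (branchLaw r p ε N).1
    set v' := (branchLaw r p ε (N + 1)).1
    have e3 : r / ((r : ℝ) - 1) * (v * (v - v')) =
        r / (2 * ((r : ℝ) - 1)) * (v ^ 2 - v' ^ 2) + r / (2 * ((r : ℝ) - 1)) * (v - v') ^ 2 := by
      field_simp
      ring
    have e4 : 0 ≤ r / (2 * ((r : ℝ) - 1)) * (v - v') ^ 2 := by positivity
    rw [e3]
    nlinarith

lemma exists_branchLaw_le (hr : 3 ≤ r) (hp0 : 0 < p) (hp1 : p < 1) {z : ℝ} (hz0 : 0 < z)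
    (hz : potential r p z = 0) {η : ℝ} (hη : 0 < η) :
    ∃ T : ℝ, 0 < T ∧ ∀ ε : ℝ, 0 < ε → ε * r ≤ 1 / 2 → ∀ N : ℕ, T ≤ ε * N →
      (branchLaw r p ε N).1 ≤ z + η := by
  have hd := denom_pos hr hp1
  by_cases hle : 1 - p ≤ z + η
  · exact ⟨1, one_pos, fun ε hε0 hε N _ =>
      (branchLaw_bounds hr hp0 hp1 hε0 hε N).2.1.trans hle⟩
  push Not at hle
  obtain ⟨x, hx, hmin⟩ := isCompact_Icc.exists_isMinOn (nonempty_Icc.2 hle.le)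
    ((continuousOn_potential (p := p) hr).mono fun y hy =>
      show (0 : ℝ) < y from lt_of_lt_of_le (by linarith) hy.1)
  have hm := potential_pos hr hp0 hp1 hz0 hz (by linarith [hx.1]) hx.2
  set m := potential r p x
  set y := (1 - p) * ((r : ℝ) - 1) * m * (z + η) ^ (r - 2) with hy
  have hy0 : 0 < y := by
    have : 0 < z + η := by linarith
    positivity
  -- While `v` stays above `z + η`, it falls at speed at least `y`; in time `1 / y` it would lose
  -- `1`, more than its initial value `1 - p`. The time does not depend on `ε`.
  refine ⟨1 / y, by positivity, fun ε hε0 hε N hN => ?_⟩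
  by_contra! hlt
  have hanti : ∀ j ≤ N, (branchLaw r p ε N).1 ≤ (branchLaw r p ε j).1 := by
    intro j hj
    exact antitone_nat_of_succ_le
      (f := fun j => (branchLaw r p ε j).1)
      (fun j => (branchLaw_bounds hr hp0 hp1 hε0 hε j).2.2.2.2.1) hj
  have hdec : ∀ j ≤ N, (branchLaw r p ε j).1 ≤ 1 - p - ε * j * y := by
    intro j
    induction j with
    | zero => intro _; simp [branchLaw]
    | succ j ih =>
      intro hj
      have ih := ih (by omega)
      obtain ⟨h1, h1', h2, h3, h4, h5⟩ := branchLaw_bounds hr hp0 hp1 hε0 hε j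
      have hv : z + η ≤ (branchLaw r p ε j).1 := hlt.le.trans (hanti j (by omega))
      have hma : m ≤ (branchLaw r p ε j).2 := (hmin ⟨hv, h1'⟩).trans h5
      have : y ≤ (1 - p) * ((r : ℝ) - 1) * (branchLaw r p ε j).2 *
          (branchLaw r p ε j).1 ^ (r - 2) := by
        rw [hy]
        have : 0 < z + η := by linarith
        gcongr
      have : ε * y ≤ ε * ((1 - p) * ((r : ℝ) - 1) * (branchLaw r p ε j).2 *
          (branchLaw r p ε j).1 ^ (r - 2)) := by gcongr
      rw [branchLaw_fst_succ]
      push_cast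
      nlinarith
  have h1 := hdec N le_rfl
  have h2 : 1 ≤ ε * N * y := by
    rw [div_le_iff₀ hy0] at hN
    exact hN
  linarith

/-- Convexity of `x ↦ x^((k+2)/2)` in the variable `x = v²`, in tangent form at `z²`. Squares are
used since `forestValue` contains `z²`. -/
lemma pow_sub_pow_le {v z : ℝ} (hv : 0 ≤ v) (hvz : v ≤ z) {k : ℕ} :
    z ^ (k + 2) - v ^ (k + 2) ≤ ((k : ℝ) + 2) / 2 * z ^ k * (z ^ 2 - v ^ 2) := by
  induction k with
  | zero => simp
  | succ k ih =>
    have hz : 0 ≤ z := hv.trans hvz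
    have h1 : v ^ (k + 1) ≤ z ^ (k + 1) := by gcongr
    have h2 : v ^ (k + 1) * v * (z - v) ≤ z ^ (k + 1) * ((z + v) / 2) * (z - v) := by
      have : 0 ≤ z - v := by linarith
      have : v ≤ (z + v) / 2 := by linarith
      gcongr
    have h3 := mul_le_mul_of_nonneg_left ih hz
    have e1 : z ^ (k + 1 + 2) - v ^ (k + 1 + 2) =
        z * (z ^ (k + 2) - v ^ (k + 2)) + v ^ (k + 1) * v * (z - v) := by ring
    have e2 : (((k + 1 : ℕ) : ℝ) + 2) / 2 * z ^ (k + 1) * (z ^ 2 - v ^ 2) =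
        z * (((k : ℝ) + 2) / 2 * z ^ k * (z ^ 2 - v ^ 2)) +
          z ^ (k + 1) * ((z + v) / 2) * (z - v) := by
      push_cast
      ring
    rw [e1, e2]
    linarith

/-- The derivative in `v` is `-r/(r-1) · v · (1 - (1-p)(r-1)v^(r-2))`, nonpositive while the
branching number is at most one. So a recursion that overshoots `z` only gains. -/
lemma forestValue_le_of_le (hr : 3 ≤ r) (hp1 : p < 1) {v z : ℝ} (hv : 0 ≤ v) (hvz : v ≤ z)
    (hz : (1 - p) * ((r : ℝ) - 1) * z ^ (r - 2) ≤ 1) :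
    forestValue r p z ≤ forestValue r p v := by
  have hr' : (3 : ℝ) ≤ r := by exact_mod_cast hr
  have hr1 : (0 : ℝ) < r - 1 := by linarith
  have h1 := pow_sub_pow_le hv hvz (k := r - 2)
  have e : r - 2 + 2 = r := by omega
  have e' : ((r - 2 : ℕ) : ℝ) + 2 = r := by exact_mod_cast e
  rw [e, e'] at h1
  have hsq : 0 ≤ z ^ 2 - v ^ 2 := by nlinarith
  have hp : 0 < 1 - p := by linarith
  have h2 : (1 - p) * (z ^ r - v ^ r) ≤ r / (2 * ((r : ℝ) - 1)) * (z ^ 2 - v ^ 2) := by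
    calc (1 - p) * (z ^ r - v ^ r) ≤ (1 - p) * ((r : ℝ) / 2 * z ^ (r - 2) * (z ^ 2 - v ^ 2)) := by
          gcongr
      _ = r / (2 * ((r : ℝ) - 1)) * (z ^ 2 - v ^ 2) *
          ((1 - p) * ((r : ℝ) - 1) * z ^ (r - 2)) := by
          field_simp
      _ ≤ r / (2 * ((r : ℝ) - 1)) * (z ^ 2 - v ^ 2) * 1 := by
          gcongr
      _ = _ := mul_one _
  unfold forestValue
  linarith

/-- Overshooting below `z` is harmless by monotonicity. Stopping above `z` loses only in the
quadratic term, by at most `v² - z² ≤ 2η`. -/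
lemma forestValue_sub_le (hr : 3 ≤ r) (hp0 : 0 < p) (hp1 : p < 1) {v z η : ℝ} (hv0 : 0 < v)
    (hv1 : v ≤ 1) (hz0 : 0 < z) (hz1 : z ≤ 1) (hη : 0 ≤ η) (hvη : v ≤ z + η)
    (hz : (1 - p) * ((r : ℝ) - 1) * z ^ (r - 2) ≤ 1) :
    forestValue r p z - 2 * η ≤ forestValue r p v := by
  have hr' : (3 : ℝ) ≤ r := by exact_mod_cast hr
  have hr1 : (0 : ℝ) < r - 1 := by linarith
  have hp : 0 < 1 - p := by linarith
  rcases le_total v z with h | h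
  · have := forestValue_le_of_le hr hp1 hv0.le h hz
    linarith
  · have h1 : v ^ 2 - z ^ 2 ≤ 2 * η := by nlinarith
    have h2 : (r : ℝ) / (2 * ((r : ℝ) - 1)) ≤ 1 := by
      rw [div_le_one (by positivity)]
      linarith
    have h3 : (r : ℝ) / (2 * ((r : ℝ) - 1)) * (v ^ 2 - z ^ 2) ≤ 2 * η := by
      have : 0 ≤ v ^ 2 - z ^ 2 := by nlinarith
      nlinarith
    have h4 : (1 - p) * z ^ r ≤ (1 - p) * v ^ r := by gcongr
    unfold forestValue
    linarith

/-- The number of rounds and the probability of choosing a vertex can be taken such that few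
conflicts arise. -/
lemma exists_step_rounds (hr : 0 < r) {T δ : ℝ} (hT : 0 < T) (hδ : 0 < δ) :
    ∃ (ε : ℝ) (N : ℕ), 0 < ε ∧ ε * r ≤ 1 / 2 ∧ T ≤ ε * N ∧ (N : ℝ) * (r * (ε * ε)) ≤ δ := by
  have hr' : (1 : ℝ) ≤ r := by exact_mod_cast hr
  have hr0 : (0 : ℝ) < r := by linarith
  obtain ⟨ε, hε0, hε, hε'⟩ : ∃ ε : ℝ, 0 < ε ∧ ε ≤ 1 / (2 * r) ∧ ε ≤ δ / (r * (T + 1)) :=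
    ⟨min (1 / (2 * r)) (δ / (r * (T + 1))), lt_min (by positivity) (by positivity),
      min_le_left _ _, min_le_right _ _⟩
  have hε1 : ε * r ≤ 1 / 2 := by
    rw [le_div_iff₀ (by positivity)] at hε
    linarith
  have hε2 : ε * (r * (T + 1)) ≤ δ := by rwa [le_div_iff₀ (by positivity)] at hε'
  have h1 := Nat.le_ceil (T / ε)
  rw [div_le_iff₀ hε0] at h1
  refine ⟨ε, ⌈T / ε⌉₊, hε0, hε1, by linarith, ?_⟩
  have h2 := (Nat.ceil_lt_add_one (div_nonneg hT.le hε0.le)).le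
  have h3 : (⌈T / ε⌉₊ : ℝ) * ε ≤ (T / ε + 1) * ε := by gcongr
  have h4 : (T / ε + 1) * ε = T + ε := by field_simp
  have h5 : ε ≤ 1 := by nlinarith
  calc (⌈T / ε⌉₊ : ℝ) * (r * (ε * ε)) = ε * (r * (⌈T / ε⌉₊ * ε)) := by ring
    _ ≤ ε * (r * (T + 1)) := by
      gcongr
      linarith
    _ ≤ δ := hε2

lemma walk_bound (hr : 3 ≤ r) (hp0 : 0 < p) (hp1 : p < 1) {v y δ : ℝ} (hv0 : 0 < v) (hv1 : v ≤ 1)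
    (hvy : v ≤ y) {K : ℕ} (hK : ((1 - p) * ((r : ℝ) - 1) * y ^ (r - 2)) ^ K < δ / r) :
    r * ((1 - p) * (((1 - p) * ((r : ℝ) - 1) * v ^ (r - 2)) ^ K * v ^ (r - 1))) ≤ δ := by
  have hr' : (3 : ℝ) ≤ r := by exact_mod_cast hr
  have hr1 : (0 : ℝ) ≤ r - 1 := by linarith
  have hp : 0 ≤ 1 - p := by linarith
  have h1 : ((1 - p) * ((r : ℝ) - 1) * v ^ (r - 2)) ^ K ≤ δ / r := by
    refine le_trans ?_ hK.le
    gcongr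
  have h2 : (1 - p) * (((1 - p) * ((r : ℝ) - 1) * v ^ (r - 2)) ^ K * v ^ (r - 1)) ≤ δ / r := by
    have h3 : 0 ≤ ((1 - p) * ((r : ℝ) - 1) * v ^ (r - 2)) ^ K := by positivity
    have h4 : v ^ (r - 1) ≤ 1 := pow_le_one₀ hv0.le hv1
    have h5 : 0 ≤ v ^ (r - 1) := by positivity
    calc (1 - p) * (((1 - p) * ((r : ℝ) - 1) * v ^ (r - 2)) ^ K * v ^ (r - 1))
        ≤ 1 * (((1 - p) * ((r : ℝ) - 1) * v ^ (r - 2)) ^ K * 1) := by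
          refine mul_le_mul (by linarith) (mul_le_mul_of_nonneg_left h4 h3)
            (mul_nonneg h3 h5) zero_le_one
      _ ≤ δ / r := by linarith
  rw [le_div_iff₀ (by linarith)] at h2
  linarith

lemma exists_subcritical_margin {z δ : ℝ} (hδ : 0 < δ)
    (hlam : (1 - p) * ((r : ℝ) - 1) * z ^ (r - 2) < 1) :
    ∃ η : ℝ, 0 < η ∧ η ≤ δ ∧ (1 - p) * ((r : ℝ) - 1) * (z + η) ^ (r - 2) < 1 := by
  have hc : ContinuousAt (fun η : ℝ => (1 - p) * ((r : ℝ) - 1) * (z + η) ^ (r - 2)) 0 := by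
    fun_prop
  have h1 : ∀ᶠ η in 𝓝[>] (0 : ℝ), (1 - p) * ((r : ℝ) - 1) * (z + η) ^ (r - 2) < 1 :=
    nhdsWithin_le_nhds (hc.eventually_lt continuousAt_const (by simpa using hlam))
  have h2 : ∀ᶠ η in 𝓝[>] (0 : ℝ), η < δ := nhdsWithin_le_nhds (Iio_mem_nhds hδ)
  have h3 : ∀ᶠ η in 𝓝[>] (0 : ℝ), 0 < η := self_mem_nhdsWithin
  obtain ⟨η, h⟩ := (h1.and (h2.and h3)).exists
  exact ⟨η, h.2.2, h.2.1.le, h.1⟩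

end BranchLaw

/-! ### The density bound for large girth. -/

section Asymptotics

universe u

/-- Regular graphs of large girth have induced forests of density close to `forestValue`. -/
theorem exists_girth_forall_le_inducedForestNumber {r : ℕ} {p : ℝ} (hr : 3 ≤ r) (hp0 : 0 < p)
    (hp1 : p < 1) {z : ℝ} (hz0 : 0 < z) (hz1 : z < 1 - p) (hz : potential r p z = 0) {δ : ℝ}
    (hδ : 0 < δ) :
    ∃ g : ℕ, 0 < g ∧ ∀ (V : Type u) [Fintype V] (G : SimpleGraph V) [DecidableRel G.Adj],
      G.IsRegularOfDegree r → (g : ℕ∞) ≤ G.egirth →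
        (forestValue r p z - δ) * (Fintype.card V : ℝ) ≤ (inducedForestNumber G : ℝ) := by
  have hr' : (3 : ℝ) ≤ r := by exact_mod_cast hr
  have hlam := branching_lt_one_of_root hr hp0 hp1 hz0 hz1 hz
  obtain ⟨η, hη0, hηδ, hη1⟩ := exists_subcritical_margin (show 0 < δ / 8 by linarith) hlam
  obtain ⟨K, hK⟩ := exists_pow_lt_of_lt_one (show 0 < δ / 4 / r by positivity) hη1
  obtain ⟨T, hT0, hT⟩ := exists_branchLaw_le hr hp0 hp1 hz0 hz hη0
  obtain ⟨ε, N, hε0, hε1, hN, hconf⟩ :=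
    exists_step_rounds (r := r) (by omega) hT0 (show 0 < δ / 4 by linarith)
  have hv := hT ε hε0 hε1 N hN
  obtain ⟨hv0, hv1, -⟩ := branchLaw_bounds hr hp0 hp1 hε0 hε1 N
  -- Branches of depth `N + K` must be disjoint, which needs girth greater than `2(N + K) + 2`.
  refine ⟨2 * (N + K) + 3, by omega, fun V _ G _ hreg hg => ?_⟩
  classical
  have hg' : ((2 * (N + K) + 2 : ℕ) : ℕ∞) < G.egirth :=
    lt_of_lt_of_le (by exact_mod_cast Nat.lt_succ_self _) hg
  have main := le_inducedForestNumber p ε hreg (by omega) hp0.le hp1.le hε0.le (by nlinarith) hg'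
    hv0.le
  refine le_trans ?_ main
  rw [mul_comm]
  refine mul_le_mul_of_nonneg_left ?_ (Nat.cast_nonneg _)
  rw [Finset.sum_sub_distrib, Finset.sum_const, Finset.card_range, nsmul_eq_mul]
  have hsum := sum_branchLaw_ge (p := p) (ε := ε) hr N
  have hwalk := walk_bound hr hp0 hp1 hv0 (by linarith) hv hK
  have hval := forestValue_sub_le hr hp0 hp1 hv0 (by linarith) hz0 (by linarith) hη0.le hv hlam.le
  unfold forestValue at hval ⊢
  linarith

end Asymptotics

/-! ### The scalar equation, its limit and its integral. -/

section ReducedEquation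

lemma antitoneOn_Ici_of_hasDerivWithinAt {f f' : ℝ → ℝ}
    (hf : ∀ x, 0 ≤ x → HasDerivWithinAt f (f' x) (Ici 0) x) (hf' : ∀ x, 0 ≤ x → f' x ≤ 0) :
    AntitoneOn f (Ici 0) := by
  have hd : ∀ x ∈ interior (Ici (0 : ℝ)), HasDerivAt f (f' x) x := fun x hx => by
    rw [interior_Ici] at hx
    exact (hf x (le_of_lt hx)).hasDerivAt (Ici_mem_nhds hx)
  refine antitoneOn_of_deriv_nonpos (convex_Ici 0) (fun x hx => (hf x hx).continuousWithinAt)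
    (fun x hx => (hd x hx).differentiableAt.differentiableWithinAt) fun x hx => ?_
  rw [(hd x hx).deriv]
  exact hf' x (interior_subset hx)

/-- A solution of a linear homogeneous equation with nonpositive coefficient that vanishes at `0`
is zero. -/
lemma eq_zero_of_hasDerivWithinAt_mul {D a : ℝ → ℝ}
    (hD : ∀ x, 0 ≤ x → HasDerivWithinAt D (a x * D x) (Ici 0) x) (ha : ∀ x, 0 ≤ x → a x ≤ 0)
    (h0 : D 0 = 0) {x : ℝ} (hx : 0 ≤ x) : D x = 0 := by
  -- `D²` has derivative `2aD² ≤ 0`, so it cannot leave its initial value `0`; no continuity or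
  -- bound on `a` is needed.
  have h := antitoneOn_Ici_of_hasDerivWithinAt (f := fun x => D x * D x)
    (f' := fun x => a x * D x * D x + D x * (a x * D x)) (fun x hx => (hD x hx).mul (hD x hx))
    (fun x hx => by nlinarith [mul_nonneg (neg_nonneg.2 (ha x hx)) (mul_self_nonneg (D x))])
    (mem_Ici.2 le_rfl) (mem_Ici.2 hx) hx
  simp only [h0, mul_zero] at h
  exact mul_self_eq_zero.1 (le_antisymm h (mul_self_nonneg _))

/-- The speed of the reduced equation. -/
noncomputable def rate (r : ℕ) (p v : ℝ) : ℝ :=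
  (1 - p) * ((r : ℝ) - 1) * v ^ (r - 2) * potential r p v

/-- `v` solves the scalar equation to which the system reduces. -/
structure IsReducedSolution (r : ℕ) (p : ℝ) (v : ℝ → ℝ) : Prop where
  init : v 0 = 1 - p
  pos : ∀ x, 0 ≤ x → 0 < v x
  rate_pos : ∀ x, 0 ≤ x → 0 < rate r p (v x)
  deriv : ∀ x, 0 ≤ x → HasDerivWithinAt v (-rate r p (v x)) (Ici 0) x

variable {r : ℕ} {p : ℝ}

/-- The derivative is written through `rate` itself so that it matches the equation satisfied by `s
/ √q`. -/
lemma hasDerivAt_rate (hr : 3 ≤ r) (hp1 : p < 1) {v : ℝ} (hv : 0 < v) :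
    HasDerivAt (rate r p) (((r : ℝ) - 2) * rate r p v / v + 1 -
      (1 - p) * ((r : ℝ) - 1) * v ^ (r - 2)) v := by
  have h := ((hasDerivAt_pow (r - 2) v).const_mul ((1 - p) * ((r : ℝ) - 1))).mul
    (hasDerivAt_potential (p := p) hr hv)
  refine HasDerivAt.congr_deriv h ?_
  have hr' : (3 : ℝ) ≤ r := by exact_mod_cast hr
  have h1 : (r : ℝ) - 1 ≠ 0 := by linarith
  have h2 : 1 - p ≠ 0 := by linarith
  obtain ⟨k, rfl⟩ : ∃ k, r = k + 3 := ⟨r - 3, by omega⟩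
  have e1 : k + 3 - 2 = k + 1 := by omega
  unfold rate potentialSlope
  rw [e1, Nat.add_sub_cancel]
  push_cast at h1 ⊢
  field_simp
  ring

lemma continuousOn_rate (hr : 3 ≤ r) (hp1 : p < 1) : ContinuousOn (rate r p) (Ioi 0) :=
  fun _ hv => (hasDerivAt_rate hr hp1 hv).continuousAt.continuousWithinAt

lemma rate_pos_iff (hr : 3 ≤ r) (hp1 : p < 1) {v : ℝ} (hv : 0 < v) :
    0 < rate r p v ↔ 0 < potential r p v := by
  have := denom_pos hr hp1
  exact mul_pos_iff_of_pos_left (by positivity)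

namespace IsReducedSolution

variable {v : ℝ → ℝ} {z : ℝ}

lemma antitoneOn (h : IsReducedSolution r p v) : AntitoneOn v (Ici 0) :=
  antitoneOn_Ici_of_hasDerivWithinAt h.deriv fun x hx => neg_nonpos.2 (h.rate_pos x hx).le

lemma le_init (h : IsReducedSolution r p v) {x : ℝ} (hx : 0 ≤ x) : v x ≤ 1 - p :=
  h.init ▸ h.antitoneOn (mem_Ici.2 le_rfl) (mem_Ici.2 hx) hx

lemma gt_root (h : IsReducedSolution r p v) (hr : 3 ≤ r) (hp0 : 0 < p) (hp1 : p < 1) (hz0 : 0 < z)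
    (hz1 : z < 1 - p) (hz : potential r p z = 0) {x : ℝ} (hx : 0 ≤ x) : z < v x := by
  have hpos := (rate_pos_iff hr hp1 (h.pos x hx)).1 (h.rate_pos x hx)
  rcases lt_trichotomy z (v x) with h' | h' | h'
  · exact h'
  · rw [← h', hz] at hpos
    exact absurd hpos (lt_irrefl 0)
  · exact absurd hpos (potential_neg hr hp0 hp1 hz0 hz1 hz (h.pos x hx) h').not_gt

lemma exists_le (h : IsReducedSolution r p v) (hr : 3 ≤ r) (hp0 : 0 < p) (hp1 : p < 1)
    (hz0 : 0 < z) (hz : potential r p z = 0) {η : ℝ} (hη : 0 < η) :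
    ∃ x, 0 ≤ x ∧ v x ≤ z + η := by
  by_contra! hcon
  have hle : z + η ≤ 1 - p := by
    rw [← h.init]
    exact (hcon 0 le_rfl).le
  obtain ⟨y, hy, hmin⟩ := isCompact_Icc.exists_isMinOn (nonempty_Icc.2 hle)
    ((continuousOn_rate hr hp1).mono fun y hy =>
      show (0 : ℝ) < y from lt_of_lt_of_le (by linarith) hy.1)
  have hm : 0 < rate r p y :=
    (rate_pos_iff hr hp1 (lt_of_lt_of_le (by linarith) hy.1)).2
      (potential_pos hr hp0 hp1 hz0 hz (by linarith [hy.1]) hy.2)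
  have hanti := antitoneOn_Ici_of_hasDerivWithinAt (f := fun x => v x + rate r p y * x)
    (fun x hx => (h.deriv x hx).add ((hasDerivWithinAt_id x (Ici 0)).const_mul (rate r p y)))
    (fun x hx => by
      have := hmin (show v x ∈ Icc (z + η) (1 - p) from ⟨(hcon x hx).le, h.le_init hx⟩)
      simp only [mem_ofPred_eq] at this
      linarith)
  have hx : (0 : ℝ) ≤ 1 / rate r p y := by positivity
  have h1 := hanti (mem_Ici.2 le_rfl) (mem_Ici.2 hx) hx
  simp only [h.init, mul_zero, add_zero, mul_one_div_cancel hm.ne'] at h1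
  linarith [h.pos _ hx]

lemma tendsto (h : IsReducedSolution r p v) (hr : 3 ≤ r) (hp0 : 0 < p) (hp1 : p < 1) (hz0 : 0 < z)
    (hz1 : z < 1 - p) (hz : potential r p z = 0) : Tendsto v atTop (𝓝 z) := by
  rw [Metric.tendsto_atTop]
  intro η hη
  obtain ⟨x, hx, hvx⟩ := h.exists_le hr hp0 hp1 hz0 hz (half_pos hη)
  refine ⟨x, fun y hy => ?_⟩
  have h1 := h.gt_root hr hp0 hp1 hz0 hz1 hz (hx.trans hy)
  have h2 := h.antitoneOn (mem_Ici.2 hx) (mem_Ici.2 (hx.trans hy)) hy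
  rw [Real.dist_eq, abs_of_pos (by linarith)]
  linarith

/-- Since `v' = -rate v`, the integrand is the derivative of `-r/(2(r-1)) · v²`, so the integral
depends only on the endpoints `1 - p` and `z`. -/
lemma integral (h : IsReducedSolution r p v) (hr : 3 ≤ r) (hp0 : 0 < p) (hp1 : p < 1) (hz0 : 0 < z)
    (hz1 : z < 1 - p) (hz : potential r p z = 0) :
    IntegrableOn (fun x => r / ((r : ℝ) - 1) * v x * rate r p (v x)) (Ioi 0) ∧
    ∫ x in Ioi 0, r / ((r : ℝ) - 1) * v x * rate r p (v x) =
      r / (2 * ((r : ℝ) - 1)) * ((1 - p) ^ 2 - z ^ 2) := by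
  have hr' : (3 : ℝ) ≤ r := by exact_mod_cast hr
  have hr1 : (0 : ℝ) < r - 1 := by linarith
  have hd : ∀ x, 0 ≤ x → HasDerivWithinAt (fun x => -(r / (2 * ((r : ℝ) - 1))) * (v x * v x))
      (r / ((r : ℝ) - 1) * v x * rate r p (v x)) (Ici 0) x := by
    intro x hx
    refine (((h.deriv x hx).mul (h.deriv x hx)).const_mul (-(r / (2 * ((r : ℝ) - 1))))).congr_deriv ?_
    field_simp
    ring
  have hlim : Tendsto (fun x => -(r / (2 * ((r : ℝ) - 1))) * (v x * v x)) atTop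
      (𝓝 (-(r / (2 * ((r : ℝ) - 1))) * (z * z))) :=
    ((h.tendsto hr hp0 hp1 hz0 hz1 hz).mul (h.tendsto hr hp0 hp1 hz0 hz1 hz)).const_mul _
  have hd' : ∀ x ∈ Ioi (0 : ℝ), HasDerivAt (fun x => -(r / (2 * ((r : ℝ) - 1))) * (v x * v x))
      (r / ((r : ℝ) - 1) * v x * rate r p (v x)) x := fun x hx =>
    (hd x (le_of_lt hx)).hasDerivAt (Ici_mem_nhds hx)
  have hnn : ∀ x ∈ Ioi (0 : ℝ), 0 ≤ r / ((r : ℝ) - 1) * v x * rate r p (v x) := fun x hx => by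
    have h1 := h.pos x (le_of_lt hx)
    have h2 := h.rate_pos x (le_of_lt hx)
    positivity
  have hc := (hd 0 le_rfl).continuousWithinAt
  refine ⟨integrableOn_Ioi_deriv_of_nonneg hc hd' hnn hlim, ?_⟩
  rw [integral_Ioi_of_hasDerivAt_of_nonneg hc hd' hnn hlim, h.init]
  ring

end IsReducedSolution

end ReducedEquation

/-! ### Invariants reducing the system to one equation. -/

section Reduction

variable {r : ℕ} {p : ℝ} {w b q s t : ℝ → ℝ}

/-- The defect `t - s²/q` is multiplied in its own derivative by a coefficient that positivity of
the solution makes negative, and it vanishes at `0`. -/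
lemma IsForestODESolution.t_eq (h : IsForestODESolution r p w b q s t) (hr : 3 ≤ r) (hp1 : p < 1)
    (hpos : ∀ x, 0 ≤ x → 0 < w x ∧ 0 < b x ∧ 0 < q x ∧ 0 < s x ∧ 0 < t x) {x : ℝ} (hx : 0 ≤ x) :
    t x = s x * s x / q x := by
  have hr' : (3 : ℝ) ≤ r := by exact_mod_cast hr
  have hr1 : (r : ℝ) - 1 ≠ 0 := by linarith
  refine sub_eq_zero.1 (eq_zero_of_hasDerivWithinAt_mul (D := fun x => t x - s x * s x / q x)
    (a := fun x => -2 - 2 * (r : ℝ) * ((r : ℝ) - 2) * t x / (((r : ℝ) - 1) * b x)) ?_ ?_ ?_ hx)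
  · intro x hx
    obtain ⟨hw, hb, hq, -, -⟩ := hpos x hx
    refine ((h.deriv_t x hx).sub (((h.deriv_s x hx).mul (h.deriv_s x hx)).div
      (h.deriv_q x hx) hq.ne')).congr_deriv ?_
    simp only [Pi.mul_apply]
    field_simp
    ring
  · intro x hx
    obtain ⟨hw, hb, hq, -, ht⟩ := hpos x hx
    have h2 : (0 : ℝ) < r - 2 := by linarith
    have h1 : (0 : ℝ) < r - 1 := by linarith
    have : 0 ≤ 2 * (r : ℝ) * ((r : ℝ) - 2) * t x / (((r : ℝ) - 1) * b x) := by positivity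
    linarith
  · simp only [h.init_t, h.init_s, h.init_q]
    have hP : 1 - p ≠ 0 := by linarith
    obtain ⟨k, rfl⟩ : ∃ k, r = k + 3 := ⟨r - 3, by omega⟩
    rw [show 2 * (k + 3) - 2 = 2 * k + 4 by omega, show 2 * (k + 3) - 1 = 2 * k + 5 by omega]
    field_simp
    ring

lemma IsForestODESolution.b_eq (h : IsForestODESolution r p w b q s t) (hr : 3 ≤ r) (hp1 : p < 1)
    (hpos : ∀ x, 0 ≤ x → 0 < w x ∧ 0 < b x ∧ 0 < q x ∧ 0 < s x ∧ 0 < t x) {x : ℝ} (hx : 0 ≤ x) :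
    b x = r / ((r : ℝ) - 1) * (s x * w x / q x) := by
  have hr' : (3 : ℝ) ≤ r := by exact_mod_cast hr
  have hr1 : (r : ℝ) - 1 ≠ 0 := by linarith
  refine sub_eq_zero.1 (eq_zero_of_hasDerivWithinAt_mul
    (D := fun x => b x - r / ((r : ℝ) - 1) * (s x * w x / q x))
    (a := fun x => -1 - (r : ℝ) * ((r : ℝ) - 2) * t x / (((r : ℝ) - 1) * b x)) ?_ ?_ ?_ hx)
  · intro x hx
    obtain ⟨hw, hb, hq, -, -⟩ := hpos x hx
    refine ((h.deriv_b x hx).sub ((((h.deriv_s x hx).mul (h.deriv_w x hx)).div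
      (h.deriv_q x hx) hq.ne').const_mul (r / ((r : ℝ) - 1)))).congr_deriv ?_
    simp only [Pi.mul_apply]
    rw [h.t_eq hr hp1 hpos hx]
    field_simp
    ring
  · intro x hx
    obtain ⟨hw, hb, hq, -, ht⟩ := hpos x hx
    have h2 : (0 : ℝ) < r - 2 := by linarith
    have h1 : (0 : ℝ) < r - 1 := by linarith
    have : 0 ≤ (r : ℝ) * ((r : ℝ) - 2) * t x / (((r : ℝ) - 1) * b x) := by positivity
    linarith
  · simp only [h.init_b, h.init_s, h.init_q, h.init_w]
    have hP : 1 - p ≠ 0 := by linarith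
    obtain ⟨k, rfl⟩ : ∃ k, r = k + 3 := ⟨r - 3, by omega⟩
    rw [show 2 * (k + 3) - 1 = 2 * k + 5 by omega]
    field_simp
    ring

/-- Every positive solution of the system comes from a solution of the reduced equation. -/
theorem IsForestODESolution.exists_reduced (h : IsForestODESolution r p w b q s t) (hr : 3 ≤ r)
    (hp1 : p < 1) (hpos : ∀ x, 0 ≤ x → 0 < w x ∧ 0 < b x ∧ 0 < q x ∧ 0 < s x ∧ 0 < t x) :
    ∃ v, IsReducedSolution r p v ∧ ∀ x, 0 ≤ x → w x = (1 - p) * v x ^ r ∧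
      q x / w x = (1 - p) * v x ^ (r - 2) ∧ b x = r / ((r : ℝ) - 1) * v x * rate r p (v x) := by
  have hr' : (3 : ℝ) ≤ r := by exact_mod_cast hr
  have hr1 : (0 : ℝ) < r - 1 := by linarith
  have hr2 : (0 : ℝ) < r - 2 := by linarith
  have hP : 0 < 1 - p := by linarith
  -- In the target coordinates `w = (1-p)v^r` and `√q = (1-p)v^(r-1)`, so `v` is this quotient; `Y`
  -- then turns out to be both `-v'` and `rate v`.
  set v : ℝ → ℝ := fun x => w x / √(q x) with hv
  set Y : ℝ → ℝ := fun x => s x / √(q x) with hY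
  have hvpos : ∀ x, 0 ≤ x → 0 < v x := fun x hx =>
    div_pos (hpos x hx).1 (Real.sqrt_pos.2 (hpos x hx).2.2.1)
  have hYpos : ∀ x, 0 ≤ x → 0 < Y x := fun x hx =>
    div_pos (hpos x hx).2.2.2.1 (Real.sqrt_pos.2 (hpos x hx).2.2.1)
  have hsq0 : √(q 0) = (1 - p) ^ r := by
    rw [h.init_q, mul_comm, pow_mul, Real.sqrt_sq (by positivity)]
  have hv0 : v 0 = 1 - p := by
    simp only [hv]
    rw [hsq0, h.init_w]
    field_simp
    ring
  have hdv : ∀ x, 0 ≤ x → HasDerivWithinAt v (-Y x) (Ici 0) x := by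
    intro x hx
    obtain ⟨hw, hb, hq, -, -⟩ := hpos x hx
    refine ((h.deriv_w x hx).div ((h.deriv_q x hx).sqrt hq.ne')
      (Real.sqrt_pos.2 hq).ne').congr_deriv ?_
    have hy := Real.sqrt_pos.2 hq
    have hyq : q x = √(q x) ^ 2 := (Real.sq_sqrt hq.le).symm
    simp only [hY]
    set y := √(q x)
    rw [hyq]
    field_simp
    ring
  have hw : ∀ x, 0 ≤ x → w x = (1 - p) * v x ^ r := by
    intro x hx
    refine sub_eq_zero.1 (eq_zero_of_hasDerivWithinAt_mul
      (D := fun x => w x - (1 - p) * v x ^ r) (a := fun x => -(r * s x / w x)) ?_ ?_ ?_ hx)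
    · intro x hx
      obtain ⟨hw, hb, hq, -, -⟩ := hpos x hx
      refine ((h.deriv_w x hx).sub (((hdv x hx).pow r).const_mul (1 - p))).congr_deriv ?_
      have hy := Real.sqrt_pos.2 hq
      have e : Y x = v x * s x / w x := by
        simp only [hY, hv]
        field_simp
      rw [e]
      obtain ⟨k, rfl⟩ : ∃ k, r = k + 3 := ⟨r - 3, by omega⟩
      rw [show k + 3 - 1 = k + 2 by omega]
      field_simp
      ring
    · intro x hx
      obtain ⟨hw, hb, hq, hs, -⟩ := hpos x hx
      have : 0 ≤ r * s x / w x := by positivity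
      linarith
    · simp only [hv0, h.init_w]
      ring
  have hqw : ∀ x, 0 ≤ x → q x / w x = (1 - p) * v x ^ (r - 2) := by
    intro x hx
    have hvx := hvpos x hx
    obtain ⟨hw0, hb, hq, hs, -⟩ := hpos x hx
    have hy := Real.sqrt_pos.2 hq
    have e : q x / w x = w x / v x ^ 2 := by
      have hyq : q x = √(q x) ^ 2 := (Real.sq_sqrt hq.le).symm
      simp only [hv]
      set y := √(q x)
      rw [hyq]
      field_simp
    rw [e, hw x hx]
    obtain ⟨k, rfl⟩ : ∃ k, r = k + 3 := ⟨r - 3, by omega⟩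
    rw [show k + 3 - 2 = k + 1 by omega]
    field_simp
    ring
  have ht : ∀ x, 0 ≤ x → t x = Y x ^ 2 := by
    intro x hx
    rw [h.t_eq hr hp1 hpos hx]
    simp only [hY]
    rw [div_pow, Real.sq_sqrt (hpos x hx).2.2.1.le, pow_two]
  have hb : ∀ x, 0 ≤ x → b x = r / ((r : ℝ) - 1) * v x * Y x := by
    intro x hx
    rw [h.b_eq hr hp1 hpos hx, mul_assoc]
    simp only [hY, hv]
    rw [div_mul_div_comm (w x), Real.mul_self_sqrt (hpos x hx).2.2.1.le, mul_comm (s x)]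
  have hdY : ∀ x, 0 ≤ x → HasDerivWithinAt Y
      (Y x * (-1 + (1 - p) * ((r : ℝ) - 1) * v x ^ (r - 2) - ((r : ℝ) - 2) * Y x / v x)) (Ici 0) x := by
    intro x hx
    obtain ⟨hw0, hb0, hq, hs, -⟩ := hpos x hx
    have hvx := hvpos x hx
    have hYx := hYpos x hx
    have hy := Real.sqrt_pos.2 hq
    refine ((h.deriv_s x hx).div ((h.deriv_q x hx).sqrt hq.ne') hy.ne').congr_deriv ?_
    have e1 : (r : ℝ) * ((r : ℝ) - 2) * s x * t x / (((r : ℝ) - 1) * b x) =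
        s x * (((r : ℝ) - 2) * Y x / v x) := by
      rw [ht x hx, hb x hx]
      field_simp
    have e2 : (1 - p) * ((r : ℝ) - 1) * v x ^ (r - 2) = ((r : ℝ) - 1) * (q x / w x) := by
      rw [hqw x hx]
      ring
    have e3 : Y x * √(q x) = s x := by
      simp only [hY]
      field_simp
    have hyq : q x = √(q x) ^ 2 := (Real.sq_sqrt hq.le).symm
    rw [e1, e2, ← e3]
    set y := √(q x)
    rw [hyq]
    field_simp
    ring
  have hrate : ∀ x, 0 ≤ x → Y x = rate r p (v x) := by
    intro x hx
    refine sub_eq_zero.1 (eq_zero_of_hasDerivWithinAt_mul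
      (D := fun x => Y x - rate r p (v x)) (a := fun x => -(((r : ℝ) - 2) * Y x / v x)) ?_ ?_ ?_ hx)
    · intro x hx
      have hvx := hvpos x hx
      refine ((hdY x hx).sub ((hasDerivAt_rate hr hp1 hvx).comp_hasDerivWithinAt x
        (hdv x hx))).congr_deriv ?_
      field_simp
      ring
    · intro x hx
      have hvx := hvpos x hx
      have hYx := hYpos x hx
      have : 0 ≤ ((r : ℝ) - 2) * Y x / v x := by positivity
      linarith
    · simp only [hv0, rate, potential_init, hY]
      rw [hsq0, h.init_s]
      obtain ⟨k, rfl⟩ : ∃ k, r = k + 3 := ⟨r - 3, by omega⟩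
      rw [show k + 3 - 2 = k + 1 by omega, show 2 * (k + 3) - 1 = 2 * k + 5 by omega]
      field_simp
      ring
  refine ⟨v, ⟨hv0, hvpos, fun x hx => hrate x hx ▸ hYpos x hx, fun x hx => hrate x hx ▸ hdv x hx⟩,
    fun x hx => ⟨hw x hx, hqw x hx, by rw [← hrate x hx, hb x hx]⟩⟩

end Reduction

/-! ### Global existence and evaluation of the constant. -/

section Existence

/-- An autonomous scalar equation whose speed is positive and at most linear above `z` has a
solution for all times that stays above `z`. -/
theorem exists_hasDerivAt_autonomous {F : ℝ → ℝ} {z a m C : ℝ} (hza : z < a) (ham : a < m)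
    (hC : 0 < C) (hcont : ContinuousOn F (Ioo z m)) (hpos : ∀ u ∈ Ioo z m, 0 < F u)
    (hlin : ∀ u ∈ Ioo z m, F u ≤ C * (u - z)) :
    ∃ v : ℝ → ℝ, v 0 = a ∧ ∀ x, 0 ≤ x → v x ∈ Ioo z m ∧ HasDerivAt v (-F (v x)) x := by
  have hinv : ContinuousOn (fun u => (F u)⁻¹) (Ioo z m) := hcont.inv₀ fun u hu => (hpos u hu).ne'
  -- The time the flow needs to get from `a` to `x`; the solution is its inverse.
  set τ : ℝ → ℝ := fun x => ∫ u in x..a, (F u)⁻¹ with hτ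
  have hint : ∀ x ∈ Ioo z m, IntervalIntegrable (fun u => (F u)⁻¹) volume x a := fun x hx =>
    (hinv.mono (ordConnected_Ioo.uIcc_subset hx ⟨hza, ham⟩)).intervalIntegrable
  have hd : ∀ x ∈ Ioo z m, HasDerivAt τ (-(F x)⁻¹) x := fun x hx =>
    intervalIntegral.integral_hasDerivAt_left (hint x hx)
      (hinv.stronglyMeasurableAtFilter isOpen_Ioo x hx)
      (hinv.continuousAt (isOpen_Ioo.mem_nhds hx))
  have hτa : τ a = 0 := intervalIntegral.integral_same
  have hτc : ContinuousOn τ (Ioo z m) := fun x hx => (hd x hx).continuousAt.continuousWithinAt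
  set M := C * (m - z) with hM
  have hM0 : 0 < M := mul_pos hC (by linarith)
  -- As `F ≤ M`, `τ` falls at rate at least `1/M`; its inverse is therefore `M`-Lipschitz.
  have hslope : AntitoneOn (fun x => τ x + M⁻¹ * x) (Ioo z m) := by
    have hd' : ∀ x ∈ Ioo z m, HasDerivAt (fun x => τ x + M⁻¹ * x) (-(F x)⁻¹ + M⁻¹ * 1) x :=
      fun x hx => (hd x hx).add ((hasDerivAt_id x).const_mul _)
    refine antitoneOn_of_deriv_nonpos (convex_Ioo z m)
      (fun x hx => (hd' x hx).continuousAt.continuousWithinAt) ?_ ?_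
    · rw [interior_Ioo]
      exact fun x hx => (hd' x hx).differentiableAt.differentiableWithinAt
    · rw [interior_Ioo]
      intro x hx
      rw [(hd' x hx).deriv]
      have h1 : F x ≤ M := (hlin x hx).trans (by rw [hM]; gcongr; exact hx.2.le)
      have h2 := inv_anti₀ (hpos x hx) h1
      linarith
  -- The linear bound makes the travel time to `x` at least `C⁻¹ log((a - z)/(x - z))`, which is
  -- unbounded: `z` is never reached in finite time.
  have hlog : AntitoneOn (fun x => τ x + C⁻¹ * Real.log (x - z)) (Ioo z m) := by
    have hd' : ∀ x ∈ Ioo z m, HasDerivAt (fun x => τ x + C⁻¹ * Real.log (x - z))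
        (-(F x)⁻¹ + C⁻¹ * (1 / (x - z))) x := fun x hx =>
      (hd x hx).add ((((hasDerivAt_id x).sub_const z).log (sub_pos.2 hx.1).ne').const_mul _)
    refine antitoneOn_of_deriv_nonpos (convex_Ioo z m)
      (fun x hx => (hd' x hx).continuousAt.continuousWithinAt) ?_ ?_
    · rw [interior_Ioo]
      exact fun x hx => (hd' x hx).differentiableAt.differentiableWithinAt
    · rw [interior_Ioo]
      intro x hx
      rw [(hd' x hx).deriv]
      have h2 := inv_anti₀ (hpos x hx) (hlin x hx)
      rw [mul_inv] at h2
      rw [one_div]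
      linarith
  have hlip : ∀ x ∈ Ioo z m, ∀ y ∈ Ioo z m, |x - y| ≤ M * |τ x - τ y| := by
    have key : ∀ x ∈ Ioo z m, ∀ y ∈ Ioo z m, x ≤ y → |x - y| ≤ M * |τ x - τ y| := by
      intro x hx y hy hxy
      have h1 := hslope hx hy hxy
      simp only at h1
      have h2 : M⁻¹ * (y - x) ≤ |τ x - τ y| := le_trans (by linarith) (le_abs_self _)
      rw [abs_sub_comm, abs_of_nonneg (by linarith)]
      rwa [inv_mul_le_iff₀ hM0] at h2
    intro x hx y hy
    rcases le_total x y with h | h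
    · exact key x hx y hy h
    · rw [abs_sub_comm, abs_sub_comm (τ x)]
      exact key y hy x hx h
  -- Room above `a` lets the inverse exist for slightly negative times too, so that it has a
  -- two-sided derivative at time `0`.
  obtain ⟨m', hm'⟩ := exists_between ham
  have hm'mem : m' ∈ Ioo z m := ⟨hza.trans hm'.1, hm'.2⟩
  have hy0 : τ m' < 0 := by
    have h1 := hslope (⟨hza, ham⟩ : a ∈ Ioo z m) hm'mem hm'.1.le
    simp only [hτa] at h1
    have h2 : 0 < M⁻¹ * (m' - a) := mul_pos (inv_pos.2 hM0) (by linarith [hm'.1])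
    linarith
  have hsurj : ∀ y, τ m' < y → ∃ x ∈ Ioo z m, τ x = y := by
    intro y hy
    -- Chosen so that the logarithmic lower bound for `τ x₀` is exactly `|y|`.
    set x₀ := z + (a - z) * Real.exp (-(C * |y|)) with hx₀
    have hexp := Real.exp_pos (-(C * |y|))
    have hexp1 : Real.exp (-(C * |y|)) ≤ 1 := by
      rw [Real.exp_le_one_iff]
      have : 0 ≤ C * |y| := by positivity
      linarith
    have hx₀z : z < x₀ := by
      have : 0 < (a - z) * Real.exp (-(C * |y|)) := mul_pos (by linarith) hexp
      linarith
    have hx₀a : x₀ ≤ a := by nlinarith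
    have h1 := hlog (⟨hx₀z, hx₀a.trans_lt ham⟩ : x₀ ∈ Ioo z m) (⟨hza, ham⟩ : a ∈ Ioo z m) hx₀a
    have h2 : x₀ - z = (a - z) * Real.exp (-(C * |y|)) := by rw [hx₀]; ring
    simp only [hτa, zero_add, h2] at h1
    rw [Real.log_mul (by linarith) hexp.ne', Real.log_exp] at h1
    have h3 : C⁻¹ * (C * |y|) = |y| := by field_simp
    have h4 : y ≤ τ x₀ := by
      have := le_abs_self y
      linarith
    have hsub : Icc x₀ m' ⊆ Ioo z m := fun u hu => ⟨hx₀z.trans_le hu.1, hu.2.trans_lt hm'.2⟩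
    obtain ⟨x, hx, hxy⟩ := intermediate_value_Icc' (hx₀a.trans hm'.1.le) (hτc.mono hsub)
      (⟨hy.le, h4⟩ : y ∈ Icc (τ m') (τ x₀))
    exact ⟨x, hsub hx, hxy⟩
  choose! v hv hτv using hsurj
  refine ⟨v, ?_, fun x hx => ?_⟩
  · have h := hlip (v 0) (hv 0 hy0) a ⟨hza, ham⟩
    rw [hτv 0 hy0, hτa, sub_self, abs_zero, mul_zero] at h
    exact sub_eq_zero.1 (abs_nonpos_iff.1 h)
  · have hx' := hy0.trans_le hx
    have hev : ∀ᶠ y in 𝓝 x, τ m' < y := Ioi_mem_nhds hx'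
    have hcv : ContinuousAt v x := by
      rw [ContinuousAt, tendsto_iff_norm_sub_tendsto_zero]
      have hb : Tendsto (fun y => M * |y - x|) (𝓝 x) (𝓝 0) := by
        have : ContinuousAt (fun y => M * |y - x|) x := by fun_prop
        simpa [ContinuousAt] using this
      refine squeeze_zero' (Eventually.of_forall fun y => norm_nonneg _) ?_ hb
      filter_upwards [hev] with y hy
      have := hlip (v y) (hv y hy) (v x) (hv x hx')
      rwa [hτv y hy, hτv x hx'] at this
    refine ⟨hv x hx', ?_⟩
    have := HasDerivAt.of_local_left_inverse hcv (hd _ (hv x hx'))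
      (neg_ne_zero.2 (inv_ne_zero (hpos _ (hv x hx')).ne')) (hev.mono fun y hy => hτv y hy)
    rwa [inv_neg, inv_inv] at this

variable {r : ℕ} {p : ℝ}

lemma exists_isReducedSolution (hr : 3 ≤ r) (hp0 : 0 < p) (hp1 : p < 1) :
    ∃ v, IsReducedSolution r p v := by
  obtain ⟨z, hz0, hz1, hz⟩ := exists_potential_eq_zero hr hp0 hp1
  have hslope := potentialSlope_pos_of_root hr hp0 hp1 hz0 hz1 hz
  have hd := denom_pos hr hp1
  obtain ⟨m, hm, hmpos⟩ : ∃ m, 1 - p < m ∧ ∀ u ∈ Ioo (1 - p) m, 0 < potential r p u := by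
    have hc : ContinuousAt (potential r p) (1 - p) :=
      (hasDerivAt_potential hr (by linarith)).continuousAt
    have h1 : ∀ᶠ u in 𝓝[>] (1 - p), 0 < potential r p u :=
      nhdsWithin_le_nhds (hc.eventually_const_lt (by rwa [potential_init]))
    obtain ⟨m, hm, hsub⟩ := mem_nhdsGT_iff_exists_Ioo_subset.1 h1
    exact ⟨m, hm, fun u hu => hsub hu⟩
  have hpot : ∀ u ∈ Ioo z m, 0 < potential r p u := by
    intro u hu
    rcases le_or_gt u (1 - p) with h | h
    · exact potential_pos hr hp0 hp1 hz0 hz hu.1 h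
    · exact hmpos u ⟨h, hu.2⟩
  have hm0 : 0 < m := by linarith
  obtain ⟨v, hv0, hv⟩ := exists_hasDerivAt_autonomous (F := rate r p) hz1 hm
    (C := (1 - p) * ((r : ℝ) - 1) * m ^ (r - 2) * potentialSlope r p z) (by positivity)
    ((continuousOn_rate hr hp1).mono fun u hu => hz0.trans hu.1)
    (fun u hu => (rate_pos_iff hr hp1 (hz0.trans hu.1)).2 (hpot u hu))
    (fun u hu => by
      have hu0 := hz0.trans hu.1
      have h1 := potential_le_tangent (r := r) hr hp1 hz0 hu0
      rw [hz, zero_add] at h1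
      have h2 : u ^ (r - 2) ≤ m ^ (r - 2) := by
        gcongr
        exact hu.2.le
      have h3 := (hpot u hu).le
      unfold rate
      calc (1 - p) * ((r : ℝ) - 1) * u ^ (r - 2) * potential r p u
          ≤ (1 - p) * ((r : ℝ) - 1) * m ^ (r - 2) * (potentialSlope r p z * (u - z)) := by gcongr
        _ = _ := by ring)
  exact ⟨v, hv0, fun x hx => hz0.trans (hv x hx).1.1,
    fun x hx => (rate_pos_iff hr hp1 (hz0.trans (hv x hx).1.1)).2 (hpot _ (hv x hx).1),
    fun x hx => (hv x hx).2.hasDerivWithinAt⟩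

/-- A solution of the reduced equation yields a solution of the system. -/
lemma IsReducedSolution.isForestODESolution {v : ℝ → ℝ} (h : IsReducedSolution r p v) (hr : 3 ≤ r)
    (hp1 : p < 1) :
    IsForestODESolution r p (fun x => (1 - p) * v x ^ r)
      (fun x => r / ((r : ℝ) - 1) * v x * rate r p (v x))
      (fun x => (1 - p) ^ 2 * v x ^ (2 * r - 2))
      (fun x => (1 - p) * v x ^ (r - 1) * rate r p (v x))
      (fun x => rate r p (v x) ^ 2) := by
  have hP : 1 - p ≠ 0 := by linarith
  have hr' : (3 : ℝ) ≤ r := by exact_mod_cast hr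
  have hr1 : (r : ℝ) - 1 ≠ 0 := by linarith
  have hrate : ∀ x, 0 ≤ x → HasDerivWithinAt (fun x => rate r p (v x))
      ((((r : ℝ) - 2) * rate r p (v x) / v x + 1 - (1 - p) * ((r : ℝ) - 1) * v x ^ (r - 2)) *
        -rate r p (v x)) (Ici 0) x := fun x hx =>
    (hasDerivAt_rate hr hp1 (h.pos x hx)).comp_hasDerivWithinAt x (h.deriv x hx)
  obtain ⟨k, rfl⟩ : ∃ k, r = k + 3 := ⟨r - 3, by omega⟩
  have e1 : k + 3 - 1 = k + 2 := by omega
  have e2 : k + 3 - 2 = k + 1 := by omega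
  have e3 : 2 * (k + 3) - 2 = 2 * k + 4 := by omega
  have e4 : 2 * (k + 3) - 1 = 2 * k + 5 := by omega
  simp only [e1, e2, e3] at hrate ⊢
  push_cast at hr1 hrate ⊢
  constructor
  · intro x hx
    refine (((h.deriv x hx).pow (k + 3)).const_mul (1 - p)).congr_deriv ?_
    rw [e1]
    push_cast
    ring
  · intro x hx
    have hv := h.pos x hx
    refine (((h.deriv x hx).const_mul (((k : ℝ) + 3) / ((k : ℝ) + 3 - 1))).mul
      (hrate x hx)).congr_deriv ?_
    push_cast
    field_simp
    ring
  · intro x hx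
    have hv := h.pos x hx
    refine (((h.deriv x hx).pow (2 * k + 4)).const_mul ((1 - p) ^ 2)).congr_deriv ?_
    rw [show 2 * k + 4 - 1 = 2 * k + 3 by omega]
    push_cast
    field_simp
    ring
  · intro x hx
    have hv := h.pos x hx
    have hR := h.rate_pos x hx
    refine ((((h.deriv x hx).pow (k + 2)).const_mul (1 - p)).mul (hrate x hx)).congr_deriv ?_
    simp only [Pi.pow_apply]
    rw [show k + 2 - 1 = k + 1 by omega]
    push_cast
    field_simp
    ring
  · intro x hx
    have hv := h.pos x hx
    have hR := h.rate_pos x hx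
    refine ((hrate x hx).pow 2).congr_deriv ?_
    push_cast
    field_simp
    ring
  · rw [h.init]
    ring
  · simp only [h.init, rate, potential_init, e2]
    push_cast
    field_simp
    ring
  · rw [h.init, ← pow_add]
    congr 1
    omega
  · simp only [h.init, rate, potential_init, e2, e4]
    push_cast
    ring
  · simp only [h.init, rate, potential_init, e2, e3]
    push_cast
    ring

/-- The constants attached to the system are the values `forestValue` at the zero of the
potential. -/
theorem isForestConstant_iff (hr : 3 ≤ r) (hp0 : 0 < p) (hp1 : p < 1) {z : ℝ} (hz0 : 0 < z)
    (hz1 : z < 1 - p) (hz : potential r p z = 0) {c : ℝ} :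
    IsForestConstant r p c ↔ c = forestValue r p z := by
  have hlam := branching_lt_one_of_root hr hp0 hp1 hz0 hz1 hz
  have hr' : (3 : ℝ) ≤ r := by exact_mod_cast hr
  constructor
  · rintro ⟨w, b, q, s, t, hsol, hpos, -, wInf, ℓ, hw, hℓ, rfl⟩
    obtain ⟨v, hv, hvw⟩ := hsol.exists_reduced hr hp1 hpos
    have hlim := hv.tendsto hr hp0 hp1 hz0 hz1 hz
    have hev : ∀ᶠ x : ℝ in atTop, 0 ≤ x := eventually_ge_atTop 0
    have h1 : Tendsto w atTop (𝓝 ((1 - p) * z ^ r)) :=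
      ((hlim.pow r).const_mul (1 - p)).congr' (hev.mono fun x hx => (hvw x hx).1.symm)
    have h2 : Tendsto (fun x => ((r : ℝ) - 1) * q x / w x) atTop
        (𝓝 (((r : ℝ) - 1) * ((1 - p) * z ^ (r - 2)))) :=
      (((hlim.pow (r - 2)).const_mul (1 - p)).const_mul ((r : ℝ) - 1)).congr'
        (hev.mono fun x hx => by
          simp only
          rw [← (hvw x hx).2.1, mul_div_assoc])
    have h3 : ∫ x in Ioi 0, b x = r / (2 * ((r : ℝ) - 1)) * ((1 - p) ^ 2 - z ^ 2) := by
      rw [← (hv.integral hr hp0 hp1 hz0 hz1 hz).2]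
      exact setIntegral_congr_fun measurableSet_Ioi fun x hx => (hvw x (le_of_lt hx)).2.2
    -- The limit of `(r - 1)q/w` is the branching number at `z`, which is less than one, so the
    -- first case always applies.
    rw [tendsto_nhds_unique hw h1, tendsto_nhds_unique hℓ h2, h3, if_pos (by linarith)]
    rfl
  · rintro rfl
    obtain ⟨v, hv⟩ := exists_isReducedSolution hr hp0 hp1
    have hlim := hv.tendsto hr hp0 hp1 hz0 hz1 hz
    have hev : ∀ᶠ x : ℝ in atTop, 0 ≤ x := eventually_ge_atTop 0
    have hP : 0 < 1 - p := by linarith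
    obtain ⟨hint, hval⟩ := hv.integral hr hp0 hp1 hz0 hz1 hz
    refine ⟨_, _, _, _, _, hv.isForestODESolution hr hp1, fun x hx => ?_, hint,
      (1 - p) * z ^ r, ((r : ℝ) - 1) * ((1 - p) * z ^ (r - 2)), (hlim.pow r).const_mul (1 - p),
      ?_, ?_⟩
    · have h1 := hv.pos x hx
      have h2 := hv.rate_pos x hx
      have h3 : (0 : ℝ) < r - 1 := by linarith
      refine ⟨?_, ?_, ?_, ?_, ?_⟩ <;> positivity
    · refine (((hlim.pow (r - 2)).const_mul (1 - p)).const_mul ((r : ℝ) - 1)).congr'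
        (hev.mono fun x hx => ?_)
      have h1 := hv.pos x hx
      obtain ⟨k, rfl⟩ : ∃ k, r = k + 3 := ⟨r - 3, by omega⟩
      simp only [show k + 3 - 2 = k + 1 by omega, show 2 * (k + 3) - 2 = 2 * k + 4 by omega]
      field_simp
      ring
    · rw [hval, if_pos (by linarith)]
      rfl

end Existence

/-! ### Rational enclosures for the table. -/

section Numerics

/-- A sign change of the potential encloses the constant. -/
lemma exists_isForestConstant_of_bracket {r : ℕ} (hr : 3 ≤ r) {p lo hi a A : ℝ} (hp0 : 0 < p)
    (hp1 : p < 1) (hlo : 0 < lo) (hlohi : lo < hi) (hhi : hi < 1 - p)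
    (hneg : potential r p lo < 0) (hpos : 0 < potential r p hi)
    (hbr : (1 - p) * ((r : ℝ) - 1) * hi ^ (r - 2) ≤ 1) (ha : a ≤ forestValue r p hi)
    (hA : forestValue r p lo < A) :
    ∃ p₀ c : ℝ, 0 < p₀ ∧ p₀ < 1 ∧ IsForestConstant r p₀ c ∧ a ≤ c ∧ c < A := by
  obtain ⟨z, hz, hz0⟩ := intermediate_value_Ioo hlohi.le
    ((continuousOn_potential (p := p) hr).mono fun z hz => hlo.trans_le hz.1)
    (show (0 : ℝ) ∈ Ioo _ _ from ⟨hneg, hpos⟩)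
  have hzpos := hlo.trans hz.1
  have hz1 := hz.2.trans hhi
  refine ⟨p, forestValue r p z, hp0, hp1,
    (isForestConstant_iff hr hp0 hp1 hzpos hz1 hz0).2 rfl,
    ha.trans (forestValue_le_of_le hr hp1 hzpos.le hz.2.le hbr), lt_of_le_of_lt ?_ hA⟩
  exact forestValue_le_of_le hr hp1 hlo.le hz.1.le (branching_lt_one_of_root hr hp0 hp1 hzpos hz1 hz0).le

/-- The fraction is `(1 - p)/hi` for `r = 3`, `p = 21/20000`, `hi = 2035/10000`; the exponent is
halved and the result squared for accuracy of the Taylor sum. The companion bound does the same at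
`lo = 2033/10000`, where the halved exponent also meets the condition of being at most one. -/
lemma lt_exp_bound : (19979 / 4070 : ℝ) < Real.exp (15912 / 10000) := by
  have h := Real.sum_le_exp_of_nonneg (show (0 : ℝ) ≤ 7956 / 10000 by norm_num) 9
  have e : Real.exp (15912 / 10000) = Real.exp (7956 / 10000) ^ 2 := by
    rw [← Real.exp_nat_mul]
    norm_num
  rw [e]
  refine lt_of_lt_of_le ?_ (pow_le_pow_left₀ (Finset.sum_nonneg fun i _ => by positivity) h 2)
  norm_num [Finset.sum_range_succ, Nat.factorial]

lemma exp_bound_lt : Real.exp (15919 / 10000) < (19979 / 4066 : ℝ) := by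
  have h := Real.exp_bound' (show (0 : ℝ) ≤ 15919 / 20000 by norm_num) (by norm_num)
    (show 0 < 9 by norm_num)
  have e : Real.exp (15919 / 10000) = Real.exp (15919 / 20000) ^ 2 := by
    rw [← Real.exp_nat_mul]
    norm_num
  rw [e]
  refine lt_of_le_of_lt (pow_le_pow_left₀ (Real.exp_pos _).le h 2) ?_
  norm_num [Finset.sum_range_succ, Nat.factorial]

lemma exists_isForestConstant_three :
    ∃ p₀ c : ℝ, 0 < p₀ ∧ p₀ < 1 ∧ IsForestConstant 3 p₀ c ∧ 0.7268 ≤ c ∧ c < 0.7268 + 1 / 10 ^ 4 := by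
  have h1 : Real.log (2035 / 10000) - Real.log (1 - 21 / 20000) > -(15912 / 10000) := by
    rw [← Real.log_div (by norm_num) (by norm_num), gt_iff_lt, Real.lt_log_iff_exp_lt (by norm_num),
      Real.exp_neg, inv_lt_comm₀ (Real.exp_pos _) (by norm_num)]
    refine lt_of_eq_of_lt ?_ lt_exp_bound
    norm_num
  have h2 : Real.log (2033 / 10000) - Real.log (1 - 21 / 20000) < -(15919 / 10000) := by
    rw [← Real.log_div (by norm_num) (by norm_num), Real.log_lt_iff_lt_exp (by norm_num),
      Real.exp_neg, lt_inv_comm₀ (by norm_num) (Real.exp_pos _)]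
    refine lt_of_lt_of_eq exp_bound_lt ?_
    norm_num
  refine exists_isForestConstant_of_bracket (p := 21 / 20000) (lo := 2033 / 10000)
    (hi := 2035 / 10000) le_rfl (by norm_num) (by norm_num) (by norm_num) (by norm_num)
    (by norm_num) ?_ ?_ (by norm_num) (by norm_num [forestValue]) (by norm_num [forestValue])
  · rw [potential, powPrimitive, powPrimitive, if_pos rfl, if_pos rfl]
    norm_num at h2 ⊢
    linarith
  · rw [potential, powPrimitive, powPrimitive, if_pos rfl, if_pos rfl]
    norm_num at h1 ⊢
    linarith

lemma exists_isForestConstant_of_mem {r : ℕ} {a A : ℝ} (h : (r, a, A) ∈ forestTable) :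
    3 ≤ r ∧ A = 1 - a ∧
      ∃ p₀ c : ℝ, 0 < p₀ ∧ p₀ < 1 ∧ IsForestConstant r p₀ c ∧ a ≤ c ∧ c < a + 1 / 10 ^ 4 := by
  simp only [forestTable, List.mem_cons, Prod.mk.injEq, List.not_mem_nil, or_false] at h
  rcases h with ⟨rfl, rfl, rfl⟩ | ⟨rfl, rfl, rfl⟩ | ⟨rfl, rfl, rfl⟩ | ⟨rfl, rfl, rfl⟩ |
    ⟨rfl, rfl, rfl⟩ | ⟨rfl, rfl, rfl⟩ | ⟨rfl, rfl, rfl⟩ | ⟨rfl, rfl, rfl⟩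
  · exact ⟨le_rfl, by norm_num, exists_isForestConstant_three⟩
  -- For `r ≥ 4` the primitive is a rational function, so no logarithm occurs and all sign
  -- conditions are rational arithmetic. The witnesses `lo` and `hi` enclose the zero of the
  -- potential for a seed density near `1/1000`.
  · refine ⟨by norm_num, by norm_num, exists_isForestConstant_of_bracket (p := 20 / 20000)
      (lo := 33347 / 100000) (hi := 33353 / 100000) ?_ ?_ ?_ ?_ ?_ ?_ ?_ ?_ ?_ ?_ ?_⟩ <;>
    norm_num [potential, powPrimitive, forestValue]
  · refine ⟨by norm_num, by norm_num, exists_isForestConstant_of_bracket (p := 19 / 20000)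
      (lo := 42164 / 100000) (hi := 42170 / 100000) ?_ ?_ ?_ ?_ ?_ ?_ ?_ ?_ ?_ ?_ ?_⟩ <;>
    norm_num [potential, powPrimitive, forestValue]
  · refine ⟨by norm_num, by norm_num, exists_isForestConstant_of_bracket (p := 22 / 20000)
      (lo := 48614 / 100000) (hi := 48620 / 100000) ?_ ?_ ?_ ?_ ?_ ?_ ?_ ?_ ?_ ?_ ?_⟩ <;>
    norm_num [potential, powPrimitive, forestValue]
  · refine ⟨by norm_num, by norm_num, exists_isForestConstant_of_bracket (p := 21 / 20000)
      (lo := 53577 / 100000) (hi := 53583 / 100000) ?_ ?_ ?_ ?_ ?_ ?_ ?_ ?_ ?_ ?_ ?_⟩ <;>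
    norm_num [potential, powPrimitive, forestValue]
  · refine ⟨by norm_num, by norm_num, exists_isForestConstant_of_bracket (p := 22 / 20000)
      (lo := 57541 / 100000) (hi := 57547 / 100000) ?_ ?_ ?_ ?_ ?_ ?_ ?_ ?_ ?_ ?_ ?_⟩ <;>
    norm_num [potential, powPrimitive, forestValue]
  · refine ⟨by norm_num, by norm_num, exists_isForestConstant_of_bracket (p := 15 / 20000)
      (lo := 60790 / 100000) (hi := 60796 / 100000) ?_ ?_ ?_ ?_ ?_ ?_ ?_ ?_ ?_ ?_ ?_⟩ <;>
    norm_num [potential, powPrimitive, forestValue]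
  · refine ⟨by norm_num, by norm_num, exists_isForestConstant_of_bracket (p := 21 / 20000)
      (lo := 63518 / 100000) (hi := 63524 / 100000) ?_ ?_ ?_ ?_ ?_ ?_ ?_ ?_ ?_ ?_ ?_⟩ <;>
    norm_num [potential, powPrimitive, forestValue]

end Numerics

/-! ### Passage to decycling sets and the theorem. -/

/-- The complement of a largest induced forest is a decycling set. -/
lemma decyclingNumber_add_inducedForestNumber_le {V : Type*} [Fintype V] (G : SimpleGraph V) :
    decyclingNumber G + inducedForestNumber G ≤ Fintype.card V := by
  classical
  obtain ⟨S, hS, hac⟩ : inducedForestNumber G ∈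
      {k : ℕ | ∃ S : Finset V, S.card = k ∧ (G.induce (S : Set V)).IsAcyclic} := by
    refine Nat.sSup_mem ⟨0, ∅, rfl, ?_⟩ ⟨Fintype.card V, ?_⟩
    · intro v
      exact absurd v.2 (by simp)
    · rintro k ⟨T, rfl, -⟩
      exact Finset.card_le_univ T
  have h1 : decyclingNumber G ≤ Sᶜ.card := Nat.sInf_le ⟨Sᶜ, rfl, by
    rw [Finset.coe_compl, compl_compl]
    exact hac⟩
  have h2 := Finset.card_add_card_compl S
  omega

theorem theorem1p1 :
    (∀ r : ℕ, 3 ≤ r → ∀ p₀ : ℝ, 0 < p₀ → p₀ < 1 →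
      (∃! c : ℝ, IsForestConstant r p₀ c) ∧
      ∀ c : ℝ, IsForestConstant r p₀ c → ∀ δ : ℝ, 0 < δ →
        ∃ g : ℕ, 0 < g ∧
          ∀ (V : Type*) [Fintype V] (G : SimpleGraph V) [DecidableRel G.Adj],
            G.IsRegularOfDegree r → (g : ℕ∞) ≤ G.egirth →
              (c - δ) * (Fintype.card V : ℝ) ≤ (inducedForestNumber G : ℝ)) ∧
    (∀ (r : ℕ) (a A : ℝ), (r, a, A) ∈ forestTable →
      A = 1 - a ∧
      (∃ p₀ c : ℝ, 0 < p₀ ∧ p₀ < 1 ∧ IsForestConstant r p₀ c ∧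
        a ≤ c ∧ c < a + 1 / 10 ^ 4) ∧
      ∀ δ : ℝ, 0 < δ →
        ∃ g : ℕ, 0 < g ∧
          ∀ (V : Type*) [Fintype V] (G : SimpleGraph V) [DecidableRel G.Adj],
            G.IsRegularOfDegree r → (g : ℕ∞) ≤ G.egirth →
              (a - δ) * (Fintype.card V : ℝ) ≤ (inducedForestNumber G : ℝ) ∧
              (decyclingNumber G : ℝ) ≤ (A + δ) * (Fintype.card V : ℝ)) := by
  have main : ∀ r : ℕ, 3 ≤ r → ∀ p₀ : ℝ, 0 < p₀ → p₀ < 1 → ∃ z, 0 < z ∧ z < 1 - p₀ ∧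
      potential r p₀ z = 0 ∧ ∀ c, IsForestConstant r p₀ c ↔ c = forestValue r p₀ z := by
    intro r hr p hp0 hp1
    obtain ⟨z, hz0, hz1, hz⟩ := exists_potential_eq_zero hr hp0 hp1
    exact ⟨z, hz0, hz1, hz, fun c => isForestConstant_iff hr hp0 hp1 hz0 hz1 hz⟩
  refine ⟨fun r hr p hp0 hp1 => ?_, fun r a A h => ?_⟩
  · obtain ⟨z, hz0, hz1, hz, hc⟩ := main r hr p hp0 hp1
    refine ⟨⟨forestValue r p z, (hc _).2 rfl, fun c h => (hc c).1 h⟩, fun c h δ hδ => ?_⟩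
    rw [(hc c).1 h]
    exact exists_girth_forall_le_inducedForestNumber hr hp0 hp1 hz0 hz1 hz hδ
  · obtain ⟨hr, rfl, p, c, hp0, hp1, hcc, hac, hcA⟩ := exists_isForestConstant_of_mem h
    refine ⟨rfl, ⟨p, c, hp0, hp1, hcc, hac, hcA⟩, fun δ hδ => ?_⟩
    obtain ⟨z, hz0, hz1, hz, hc⟩ := main r hr p hp0 hp1
    obtain ⟨g, hg, hG⟩ := exists_girth_forall_le_inducedForestNumber hr hp0 hp1 hz0 hz1 hz hδ
    refine ⟨g, hg, fun V _ G _ hreg hgirth => ?_⟩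
    have h1 := hG V G hreg hgirth
    rw [← (hc c).1 hcc] at h1
    have h2 : (a - δ) * (Fintype.card V : ℝ) ≤ (inducedForestNumber G : ℝ) := by
      refine le_trans ?_ h1
      gcongr
    refine ⟨h2, ?_⟩
    have h3 : (decyclingNumber G : ℝ) + inducedForestNumber G ≤ Fintype.card V := by
      exact_mod_cast decyclingNumber_add_inducedForestNumber_le G
    linarith
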